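/- **Setting.** Let $m$ be a natural number, $[m]=\{1,\dots,m\}$, $\mathcal R=\mathbb F_2[\xi,\eta]/\langle \xi^2,\eta^2,\xi\eta-\eta\xi\rangle$, let $u,v\in\mathcal R$ be the classes of $\xi,\eta$, and let $\mathbf b_1=1+u+v$, $\mathbf b_2=u+v$, $\mathbf b_3=u$, $\mathbf b_4=uv$, an $\mathbb F_2$-basis of $\mathcal R$. For $X\subseteq[m]$ put $\Delta_X=\{t\in\mathbb F_2^m:\operatorname{Supp}(t)\subseteq X\}$ and $\Delta_X^c=\mathbb F_2^m\setminus\Delta_X$. For $D_1,\dots,D_4\subseteq\mathbb F_2^m$ put $\mathbf b_1D_1+\mathbf b_2D_2+\mathbf b_3D_3+\mathbf b_4D_4=\{\mathbf b_1t_1+\mathbf b_2t_2+\mathbf b_3t_3+\mathbf b_4t_4: t_i\in D_i\}\subseteq\mathcal R^m$. For $D\subseteq\mathcal R^m$ let $\mathcal C_D=\{(\mathbf z\cdot d)_{d\in D}:\mathbf z\in\mathcal R^m\}$, a linear code over $\mathcal R$ of length $|D|$, and let $\mathcal C_D^{(2)}$ be its binary subfield code: the $\mathbb F_2$-linear code generated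 by the rows of the matrix obtained from a generator matrix of $\mathcal C_D$ by replacing each entry by the column of its coordinates in the basis $\mathbf b_1,\dots,\mathbf b_4$. (It does not depend on the generator matrix.) For a binary linear code $C$ of length $n$, dimension $k$ and minimum distance $d$ (the least Hamming weight of a non-zero codeword), let $A_j$ be the number of codewords of weight $j$. $C$ is *$t$-weight* if exactly $t$ of $A_1,\dots,A_n$ are non-zero; *distance-optimal* if no binary linear code of length $n$ and dimension $k$ has minimum distance $d+1$; it *attains the Griesmer bound* if $n=\sum_{i=0}^{k-1}\lceil d/2^i\rceil$. A weight distribution is given below as a list of (weight : frequency); $A_j=0$ for unlisted weights $j$. **Theorem 4.2.** Let $X,Y,Z,W\subseteq[m]$, and write $x=|X|$, $y=|Y|$, $z=|Z|$, $w=|W|$. 1. Let $D=\mathbf b_1\Delta_X+\mathbf b_2\Delta_Y+\mathbf b_3\Delta_Z+\mathbf b_4\Delta_W$ with $X,Y,Z,W$ not all empty. Then $\mathcal C_D^{(2)}$ is a one-weight code with length $2^{x+y+z+w}$, dimension $x+y+z+w$, minimum distance $2^{x+y+z+w-1}$ and weight distribution - $0$ : $1$ - $2^{x+y+z+w-1}$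 : $2^{x+y+z+w}-1$. If $x+y+z+w\ge2$, it is distance-optimal. 2. Let $D=\mathbf b_1\Delta_X^c+\mathbf b_2\Delta_Y+\mathbf b_3\Delta_Z+\mathbf b_4\Delta_W$ with $x<m$ and $X,Y,Z,W$ not all empty. Then $\mathcal C_D^{(2)}$ is a two-weight code with length $(2^m-2^x)2^{y+z+w}$, dimension $m+y+z+w$, minimum distance $(2^m-2^x)2^{y+z+w-1}$ and weight distribution - $0$ : $1$ - $2^{m+y+z+w-1}$ : $2^{m-x}-1$ - $(2^m-2^x)2^{y+z+w-1}$ : $2^{m+y+z+w}-2^{m-x}$. It attains the Griesmer bound and is distance-optimal. 3. Let $D=\mathbf b_1\Delta_X^c+\mathbf b_2\Delta_Y^c+\mathbf b_3\Delta_Z+\mathbf b_4\Delta_W$ with $x\ne y$ and $x,y<m$. Then $\mathcal C_D^{(2)}$ is a four-weight code with length $(2^m-2^x)(2^m-2^y)2^{z+w}$, dimension $2m+z+w$, minimum distance $(2^m-2^x-2^y)2^{m+z+w-1}$ and weight distribution - $0$ : $1$ - $(2^m-2^x)2^{m+z+w-1}$ : $2^{m-y}-1$ - $(2^m-2^y)2^{m+z+w-1}$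 : $2^{m-x}-1$ - $(2^m-2^x-2^y)2^{m+z+w-1}$ : $2^{2m-x-y}-2^{m-y}-2^{m-x}+1$ - $(2^m-2^x)(2^m-2^y)2^{z+w-1}$ : $2^{2m+z+w}-2^{2m-x-y}$. If $2^{x+y+z+w}\le m+z+w+\min\{x,y\}$, it is distance-optimal. 4. Let $D=\mathbf b_1\Delta_X^c+\mathbf b_2\Delta_Y^c+\mathbf b_3\Delta_Z^c+\mathbf b_4\Delta_W$ with $x,y,z$ distinct and $x,y,z<m$. Then $\mathcal C_D^{(2)}$ is an eight-weight code with length $(2^m-2^x)(2^m-2^y)(2^m-2^z)2^w$, dimension $3m+w$, minimum distance $(2^m-2^{s_1})(2^m-2^{s_2}-2^{s_3})2^{m+w-1}$, where $s_1<s_2<s_3$ and $\{s_1,s_2,s_3\}=\{x,y,z\}$, and weight distribution - $0$ : $1$ - $(2^m-2^a)(2^m-2^b)2^{m+w-1}$ : $2^{m-c}-1$, for $(a,b,c)=(x,y,z),(x,z,y),(y,z,x)$ - $(2^m-2^a)(2^m-2^b-2^c)2^{m+w-1}$ : $2^{2m-b-c}-2^{m-b}-2^{m-c}+1$, for $(a,b,c)=(x,y,z),(y,x,z),(z,x,y)$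 - $(2^{2m}-2^{m+x}-2^{m+y}-2^{m+z}+2^{x+y}+2^{y+z}+2^{x+z})2^{m+w-1}$ : $2^{3m-x-y-z}-2^{2m-y-z}-2^{2m-x-z}-2^{2m-x-y}+2^{m-z}+2^{m-y}+2^{m-x}-1$ - $(2^m-2^x)(2^m-2^y)(2^m-2^z)2^{w-1}$ : $2^{3m+w}-2^{3m-x-y-z}$. 5. Let $D=\mathbf b_1\Delta_X^c+\mathbf b_2\Delta_Y^c+\mathbf b_3\Delta_Z^c+\mathbf b_4\Delta_W^c$ with $x,y,z,w$ distinct and $x,y,z,w<m$. Then $\mathcal C_D^{(2)}$ is a sixteen-weight code with length $(2^m-2^x)(2^m-2^y)(2^m-2^z)(2^m-2^w)$, dimension $4m$, minimum distance $(2^m-2^{s_1})(2^m-2^{s_2})(2^m-2^{s_3}-2^{s_4})2^{m-1}$, where $s_1<s_2<s_3<s_4$ and $\{s_1,s_2,s_3,s_4\}=\{x,y,z,w\}$, and weight distribution, where $(a,b,c,e)$ is any ordering of $(x,y,z,w)$ and each unordered choice gives one row, - $0$ : $1$ - $(2^m-2^a)(2^m-2^b)(2^m-2^c)2^{m-1}$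 : $2^{m-e}-1$ (four rows, one for each $e$) - $(2^m-2^a)(2^m-2^b)(2^m-2^c-2^e)2^{m-1}$ : $2^{2m-c-e}-2^{m-c}-2^{m-e}+1$ (six rows, one for each $\{c,e\}$) - $(2^m-2^a)(2^{2m}-2^{m+b}-2^{m+c}-2^{m+e}+2^{b+c}+2^{b+e}+2^{c+e})2^{m-1}$ : $2^{3m-b-c-e}-2^{2m-b-c}-2^{2m-b-e}-2^{2m-c-e}+2^{m-b}+2^{m-c}+2^{m-e}-1$ (four rows, one for each $a$) - $(2^{3m}-2^{2m+x}-2^{2m+y}-2^{2m+z}-2^{2m+w}+2^{m+x+y}+2^{m+x+z}+2^{m+x+w}+2^{m+y+z}+2^{m+y+w}+2^{m+z+w}-2^{x+y+z}-2^{x+y+w}-2^{x+z+w}-2^{y+z+w})2^{m-1}$ : $2^{4m-x-y-z-w}-2^{3m-x-y-z}-2^{3m-x-y-w}-2^{3m-x-z-w}-2^{3m-y-z-w}+2^{2m-x-y}+2^{2m-x-z}+2^{2m-x-w}+2^{2m-y-z}+2^{2m-y-w}+2^{2m-z-w}-2^{m-x}-2^{m-y}-2^{m-z}-2^{m-w}+1$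 - $(2^m-2^x)(2^m-2^y)(2^m-2^z)(2^m-2^w)2^{-1}$ : $2^{4m}-2^{4m-x-y-z-w}$. 6. Let $D=\mathbf b_1\Delta_X+\mathbf b_2\Delta_Y+\mathbf b_3\Delta_Z+\mathbf b_4\Delta_W$ with $X,Y,Z,W$ neither all empty nor all equal to $[m]$, and let $D^c=\mathcal R^m\setminus D$. Then $\mathcal C_{D^c}^{(2)}$ is a two-weight code with length $2^{4m}-2^{x+y+z+w}$, dimension $4m$, minimum distance $2^{4m-1}-2^{x+y+z+w-1}$ and weight distribution - $0$ : $1$ - $2^{4m-1}$ : $2^{4m-x-y-z-w}-1$ - $2^{4m-1}-2^{x+y+z+w-1}$ : $2^{4m}-2^{4m-x-y-z-w}$. It attains the Griesmer bound and is distance-optimal. -/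

import Mathlib

open scoped BigOperators

namespace SubfieldCode

/-! ### Linear codes over a finite field, binary case

A binary linear code whose coordinates are indexed by the finite type `ι` is a
`Submodule (ZMod 2) (ι → ZMod 2)`; the Hamming weight is `hammingNorm`. -/

section Codes

variable {ι : Type*} [Fintype ι]

/-- The length of a code. -/
def length (_C : Submodule (ZMod 2) (ι → ZMod 2)) : ℕ := Fintype.card ι

/-- The dimension of a code. -/
noncomputable def dimension (C : Submodule (ZMod 2) (ι → ZMod 2)) : ℕ := Module.finrank (ZMod 2) C

/-- The minimum distance: the least weight of a non-zero codeword (`0` only for the zero code,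
which has none). -/
noncomputable def minDist (C : Submodule (ZMod 2) (ι → ZMod 2)) : ℕ :=
  sInf {w : ℕ | ∃ c ∈ C, c ≠ 0 ∧ hammingNorm c = w}

/-- `A_j`, the number of codewords of weight `j`. -/
noncomputable def weightCount (C : Submodule (ZMod 2) (ι → ZMod 2)) (j : ℕ) : ℕ :=
  Set.ncard {c : ι → ZMod 2 | c ∈ C ∧ hammingNorm c = j}

/-- Exactly `t` of `A_1, …, A_n` are non-zero, `n` being the length. -/
def IsWeight (t : ℕ) (C : Submodule (ZMod 2) (ι → ZMod 2)) : Prop :=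
  ((Finset.Icc 1 (length C)).filter (fun j => weightCount C j ≠ 0)).card = t

/-- The weight distribution is given by a table whose rows are pairs (weight, frequency):
`A_j` is the total frequency listed for the weight `j`, in particular `0` if `j` is not listed.
The entries are rational numbers, so that differences and the exponents `-1` in the tables have
their usual meaning. -/
def HasWeightTable (C : Submodule (ZMod 2) (ι → ZMod 2)) (T : List (ℚ × ℚ)) : Prop :=
  ∀ j : ℕ, (weightCount C j : ℚ) = (T.map fun r => if r.1 = (j : ℚ) then r.2 else 0).sum

/-- An `[n, k, d]` code is distance-optimal if there is no `[n, k, d + 1]` code. -/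
def IsDistanceOptimal (C : Submodule (ZMod 2) (ι → ZMod 2)) : Prop :=
  ¬ ∃ C' : Submodule (ZMod 2) (Fin (length C) → ZMod 2),
    dimension C' = dimension C ∧ minDist C' = minDist C + 1

/-- The code meets the Griesmer bound `n ≥ ∑_{i < k} ⌈d / 2 ^ i⌉` with equality. -/
def AttainsGriesmer (C : Submodule (ZMod 2) (ι → ZMod 2)) : Prop :=
  length C = ∑ i ∈ Finset.range (dimension C), ⌈(minDist C : ℚ) / 2 ^ i⌉₊

end Codes

/-! ### Subfield codes -/

section Subfield

variable {K R ι β : Type*} [Field K] [CommRing R] [Algebra K R]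

/-- The subfield code of the `R`-linear code `C` with respect to a `K`-basis `b` of `R`: replace
every entry of a generator matrix by the column of its `b`-coordinates, and take the `K`-span of
the rows. All codewords are used as rows here; by `subfieldCode_eq_span` any generator
matrix of `C`, and any basis of `R`, yields the same code. -/
def subfieldCode (b : Module.Basis β K R) (C : Submodule R (ι → R)) : Submodule K (ι → K) :=
  Submodule.span K {w | ∃ c ∈ C, ∃ i : β, w = fun j => b.repr (c j) i}

theorem subfieldCode_eq_span {κ γ : Type*} [Finite β] [Finite γ] (b : Module.Basis β K R)
    (b' : Module.Basis γ K R)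
    (C : Submodule R (ι → R)) (G : κ → ι → R) (hG : Submodule.span R (Set.range G) = C) :
    subfieldCode b C = Submodule.span K {w | ∃ k, ∃ i : γ, w = fun j => b'.repr (G k j) i} := by
  have := Fintype.ofFinite γ
  have key : ∀ c ∈ Submodule.span R (Set.range G), ∀ f : R →ₗ[K] K, (fun j => f (c j)) ∈
      Submodule.span K {w | ∃ k, ∃ i : γ, w = fun j => b'.repr (G k j) i} := by
    intro c hc
    induction hc using Submodule.span_induction with
    | mem x hx =>
      obtain ⟨k, rfl⟩ := hx
      intro f
      have : (fun j => f (G k j)) = ∑ i, f (b' i) • (fun j => b'.repr (G k j) i) := by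
        funext j
        conv_lhs => rw [← b'.sum_repr (G k j)]
        simp only [map_sum, map_smul, smul_eq_mul, Finset.sum_apply, Pi.smul_apply, mul_comm]
      rw [this]
      exact Submodule.sum_mem _ fun i _ => Submodule.smul_mem _ _
        (Submodule.subset_span ⟨k, i, rfl⟩)
    | zero =>
      intro f
      have h : (fun j : ι => f ((0 : ι → R) j)) = 0 := by funext j; simp
      rw [h]
      exact Submodule.zero_mem _
    | add x y _ _ hx hy =>
      intro f
      have h : (fun j : ι => f ((x + y) j)) = (fun j => f (x j)) + fun j => f (y j) := by
        funext j; simp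
      rw [h]
      exact Submodule.add_mem _ (hx f) (hy f)
    | smul a x _ hx =>
      intro f
      simpa using hx (f ∘ₗ LinearMap.mulLeft K a)
  apply le_antisymm
  · refine Submodule.span_le.2 ?_
    rintro _ ⟨c, hc, i, rfl⟩
    subst hG
    exact key c hc (b.coord i)
  · refine Submodule.span_le.2 ?_
    rintro _ ⟨k, i, rfl⟩
    have := Fintype.ofFinite β
    have h : (fun j => b'.repr (G k j) i) =
        ∑ l, (b'.coord i) (b l) • (fun j => b.repr (G k j) l) := by
      funext j
      have : b'.repr (G k j) i = b'.coord i (G k j) := rfl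
      rw [this]
      conv_lhs => rw [← b.sum_repr (G k j)]
      simp only [map_sum, map_smul, smul_eq_mul, Finset.sum_apply, Pi.smul_apply, mul_comm]
    rw [h]
    exact Submodule.sum_mem _ fun l _ => Submodule.smul_mem _ _
      (Submodule.subset_span ⟨G k, hG ▸ Submodule.subset_span ⟨k, rfl⟩, l, rfl⟩)

/-- The linear code `{(z · d)_{d ∈ D} : z ∈ R ^ m}` over `R` with defining set `D ⊆ R ^ m`; its
coordinates are indexed by the elements of `D`. -/
def codeOfDefiningSet {m : ℕ} (D : Finset (Fin m → R)) : Submodule R (D → R) where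
  carrier := {c | ∃ z : Fin m → R, c = fun d => z ⬝ᵥ d.1}
  zero_mem' := ⟨0, by funext d; simp⟩
  add_mem' := by
    rintro _ _ ⟨z, rfl⟩ ⟨z', rfl⟩
    exact ⟨z + z', by funext d; simp [add_dotProduct]⟩
  smul_mem' := by
    rintro a _ ⟨z, rfl⟩
    exact ⟨a • z, by funext d; simp [smul_dotProduct]⟩

end Subfield

/-! ### The ring `𝔽₂[x, y] / ⟨x², y², xy - yx⟩` and its basis -/

/-- The ring `𝔽₂[x, y] / ⟨x², y², xy - yx⟩`. -/
abbrev Rng : Type :=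
  MvPolynomial (Fin 2) (ZMod 2) ⧸
    (Ideal.span {MvPolynomial.X 0 ^ 2, MvPolynomial.X 1 ^ 2,
      MvPolynomial.X 0 * MvPolynomial.X 1 - MvPolynomial.X 1 * MvPolynomial.X 0} :
      Ideal (MvPolynomial (Fin 2) (ZMod 2)))

/-- The class of `x`. -/
noncomputable def u : Rng := Ideal.Quotient.mk _ (MvPolynomial.X 0)

/-- The class of `y`. -/
noncomputable def v : Rng := Ideal.Quotient.mk _ (MvPolynomial.X 1)

theorem u_mul_u : u * u = 0 := by
  rw [u, ← map_mul, Ideal.Quotient.eq_zero_iff_mem, ← pow_two]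
  exact Ideal.subset_span (by simp)

theorem v_mul_v : v * v = 0 := by
  rw [v, ← map_mul, Ideal.Quotient.eq_zero_iff_mem, ← pow_two]
  exact Ideal.subset_span (by simp)

/-- The elements `b₁ = 1 + u + v`, `b₂ = u + v`, `b₃ = u`, `b₄ = uv`. -/
noncomputable def bvec : Fin 4 → Rng := ![1 + u + v, u + v, u, u * v]

/-- The images of `x` and `y` in the iterated dual numbers. -/
def dualGen : Fin 2 → DualNumber (DualNumber (ZMod 2)) :=
  ![TrivSqZeroExt.inl DualNumber.eps, DualNumber.eps]

/-- The map to the iterated dual numbers, used to read off coordinates. -/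
noncomputable def toDual : Rng →ₐ[ZMod 2] DualNumber (DualNumber (ZMod 2)) :=
  Ideal.Quotient.liftₐ _ (MvPolynomial.aeval dualGen) (by
    intro a ha
    have h : (Ideal.span {MvPolynomial.X 0 ^ 2, MvPolynomial.X 1 ^ 2,
        MvPolynomial.X 0 * MvPolynomial.X 1 - MvPolynomial.X 1 * MvPolynomial.X 0} :
        Ideal (MvPolynomial (Fin 2) (ZMod 2))) ≤
        RingHom.ker (MvPolynomial.aeval (R := ZMod 2) dualGen) := by
      rw [Ideal.span_le]
      rintro p (rfl | rfl | rfl)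
      · simp [dualGen, RingHom.mem_ker, pow_two, ← TrivSqZeroExt.inl_mul]
      · simp [dualGen, RingHom.mem_ker, pow_two]
      · simp [dualGen, mul_comm]
    exact h ha)

theorem toDual_u : toDual u = TrivSqZeroExt.inl DualNumber.eps := by
  change MvPolynomial.aeval dualGen (MvPolynomial.X 0) = _
  simp [dualGen]

theorem toDual_v : toDual v = DualNumber.eps := by
  change MvPolynomial.aeval dualGen (MvPolynomial.X 1) = _
  simp [dualGen]

theorem bvec_linearIndependent : LinearIndependent (ZMod 2) bvec := by
  rw [Fintype.linearIndependent_iff]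
  intro g hg
  have h := congrArg toDual hg
  simp only [bvec, Fin.sum_univ_four, map_add, map_smul, map_mul, map_one, toDual_u, toDual_v,
    Matrix.cons_val, map_zero] at h
  have h1 := congrArg (fun t => t.fst.fst) h
  have h2 := congrArg (fun t => t.fst.snd) h
  have h3 := congrArg (fun t => t.snd.fst) h
  have h4 := congrArg (fun t => t.snd.snd) h
  simp at h1 h2 h3 h4
  intro i
  fin_cases i <;> grind

theorem bvec_span : ⊤ ≤ Submodule.span (ZMod 2) (Set.range bvec) := by
  set S := Submodule.span (ZMod 2) (Set.range bvec) with hS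
  have e : ∀ i, bvec i ∈ S := fun i => Submodule.subset_span ⟨i, rfl⟩
  have hu : u ∈ S := e 2
  have hv : v ∈ S := by
    have := S.sub_mem (e 1) (e 2)
    simpa [bvec] using this
  have h1 : (1 : Rng) ∈ S := by
    have := S.sub_mem (e 0) (e 1)
    simpa [bvec, add_assoc] using this
  have huv : u * v ∈ S := e 3
  have mulu : ∀ r ∈ S, r * u ∈ S := by
    intro r hr
    induction hr using Submodule.span_induction with
    | mem x hx =>
      obtain ⟨i, rfl⟩ := hx
      fin_cases i
      · have : (1 + u + v) * u = u + u * v := by linear_combination u_mul_u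
        simpa [bvec, this] using S.add_mem hu huv
      · have : (u + v) * u = u * v := by linear_combination u_mul_u
        simpa [bvec, this] using huv
      · simp [bvec, u_mul_u]
      · have : u * v * u = 0 := by linear_combination v * u_mul_u
        simp [bvec, this]
    | zero => simp
    | add x y _ _ hx hy => rw [add_mul]; exact S.add_mem hx hy
    | smul a x _ hx => rw [smul_mul_assoc]; exact S.smul_mem _ hx
  have mulv : ∀ r ∈ S, r * v ∈ S := by
    intro r hr
    induction hr using Submodule.span_induction with
    | mem x hx =>
      obtain ⟨i, rfl⟩ := hx
      fin_cases i
      · have : (1 + u + v) * v = v + u * v := by linear_combination v_mul_v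
        simpa [bvec, this] using S.add_mem hv huv
      · have : (u + v) * v = u * v := by linear_combination v_mul_v
        simpa [bvec, this] using huv
      · simpa [bvec] using huv
      · have : u * v * v = 0 := by linear_combination u * v_mul_v
        simp [bvec, this]
    | zero => simp
    | add x y _ _ hx hy => rw [add_mul]; exact S.add_mem hx hy
    | smul a x _ hx => rw [smul_mul_assoc]; exact S.smul_mem _ hx
  rintro r -
  obtain ⟨p, rfl⟩ := Ideal.Quotient.mk_surjective r
  induction p using MvPolynomial.induction_on with
  | C a =>
    have := S.smul_mem a h1
    rw [Algebra.smul_def (R := ZMod 2) (A := Rng), mul_one] at this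
    exact this
  | add p q hp hq => rw [map_add]; exact S.add_mem hp hq
  | mul_X p i hp =>
    rw [map_mul]
    fin_cases i
    · exact mulu _ hp
    · exact mulv _ hp

/-- The `𝔽₂`-basis `b₁, b₂, b₃, b₄` of the ring. -/
noncomputable def bBasis : Module.Basis (Fin 4) (ZMod 2) Rng :=
  Module.Basis.mk bvec_linearIndependent bvec_span

noncomputable instance : Fintype Rng :=
  Fintype.ofEquiv (Fin 4 → ZMod 2) bBasis.equivFun.symm.toEquiv

/-! ### Defining sets from simplicial complexes -/

/-- The simplicial complex `Δ_X = {t ∈ 𝔽₂ ^ m : Supp t ⊆ X}` generated by `X`. -/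
def simplicial {m : ℕ} (X : Finset (Fin m)) : Finset (Fin m → ZMod 2) :=
  Finset.univ.filter fun t => ∀ i, t i ≠ 0 → i ∈ X

open Classical in
/-- The set `b₁ D₁ + b₂ D₂ + b₃ D₃ + b₄ D₄` of vectors over the ring. -/
noncomputable def definingSet {m : ℕ} (D₁ D₂ D₃ D₄ : Finset (Fin m → ZMod 2)) :
    Finset (Fin m → Rng) :=
  Finset.univ.filter fun r => ∃ t₁ ∈ D₁, ∃ t₂ ∈ D₂, ∃ t₃ ∈ D₃, ∃ t₄ ∈ D₄,
    r = fun i => t₁ i • bvec 0 + t₂ i • bvec 1 + t₃ i • bvec 2 + t₄ i • bvec 3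

open Classical in
/-- The complement of a set of vectors over the ring. -/
noncomputable def complSet {m : ℕ} (D : Finset (Fin m → Rng)) : Finset (Fin m → Rng) := Dᶜ

/-- The binary subfield code `C_D^{(2)}` of the code over the ring with defining set `D`. -/
noncomputable def binaryCode {m : ℕ} (D : Finset (Fin m → Rng)) :
    Submodule (ZMod 2) (D → ZMod 2) :=
  subfieldCode bBasis (codeOfDefiningSet D)

/-! ### The tables of weights and frequencies -/

/-- No complement. -/
def table0 (x y z w : ℕ) : List (ℚ × ℚ) :=
  [(0, 1),
   (2 ^ (x + y + z + w - 1 : ℤ), 2 ^ (x + y + z + w) - 1)]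

/-- One complement. -/
def table1 (m x y z w : ℕ) : List (ℚ × ℚ) :=
  [(0, 1),
   (2 ^ (m + y + z + w - 1 : ℤ), 2 ^ (m - x : ℤ) - 1),
   ((2 ^ m - 2 ^ x) * 2 ^ (y + z + w - 1 : ℤ), 2 ^ (m + y + z + w) - 2 ^ (m - x : ℤ))]

/-- Two complements. -/
def table2 (m x y z w : ℕ) : List (ℚ × ℚ) :=
  [(0, 1),
   ((2 ^ m - 2 ^ x) * 2 ^ (m + z + w - 1 : ℤ), 2 ^ (m - y : ℤ) - 1),
   ((2 ^ m - 2 ^ y) * 2 ^ (m + z + w - 1 : ℤ), 2 ^ (m - x : ℤ) - 1),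
   ((2 ^ m - 2 ^ x - 2 ^ y) * 2 ^ (m + z + w - 1 : ℤ),
    2 ^ (2 * m - x - y : ℤ) - 2 ^ (m - y : ℤ) - 2 ^ (m - x : ℤ) + 1),
   ((2 ^ m - 2 ^ x) * (2 ^ m - 2 ^ y) * 2 ^ (z + w - 1 : ℤ),
    2 ^ (2 * m + z + w) - 2 ^ (2 * m - x - y : ℤ))]

/-- Three complements. -/
def table3 (m x y z w : ℕ) : List (ℚ × ℚ) :=
  [(0, 1),
   ((2 ^ m - 2 ^ x) * (2 ^ m - 2 ^ y) * 2 ^ (m + w - 1 : ℤ), 2 ^ (m - z : ℤ) - 1),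
   ((2 ^ m - 2 ^ x) * (2 ^ m - 2 ^ z) * 2 ^ (m + w - 1 : ℤ), 2 ^ (m - y : ℤ) - 1),
   ((2 ^ m - 2 ^ y) * (2 ^ m - 2 ^ z) * 2 ^ (m + w - 1 : ℤ), 2 ^ (m - x : ℤ) - 1),
   ((2 ^ m - 2 ^ x) * (2 ^ m - 2 ^ y - 2 ^ z) * 2 ^ (m + w - 1 : ℤ),
    2 ^ (2 * m - y - z : ℤ) - 2 ^ (m - y : ℤ) - 2 ^ (m - z : ℤ) + 1),
   ((2 ^ m - 2 ^ y) * (2 ^ m - 2 ^ x - 2 ^ z) * 2 ^ (m + w - 1 : ℤ),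
    2 ^ (2 * m - x - z : ℤ) - 2 ^ (m - x : ℤ) - 2 ^ (m - z : ℤ) + 1),
   ((2 ^ m - 2 ^ z) * (2 ^ m - 2 ^ x - 2 ^ y) * 2 ^ (m + w - 1 : ℤ),
    2 ^ (2 * m - x - y : ℤ) - 2 ^ (m - x : ℤ) - 2 ^ (m - y : ℤ) + 1),
   ((2 ^ (2 * m) - 2 ^ (m + x) - 2 ^ (m + y) - 2 ^ (m + z)
      + 2 ^ (x + y) + 2 ^ (y + z) + 2 ^ (x + z)) * 2 ^ (m + w - 1 : ℤ),
    2 ^ (3 * m - x - y - z : ℤ)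
      - 2 ^ (2 * m - y - z : ℤ) - 2 ^ (2 * m - x - z : ℤ) - 2 ^ (2 * m - x - y : ℤ)
      + 2 ^ (m - z : ℤ) + 2 ^ (m - y : ℤ) + 2 ^ (m - x : ℤ) - 1),
   ((2 ^ m - 2 ^ x) * (2 ^ m - 2 ^ y) * (2 ^ m - 2 ^ z) * 2 ^ (w - 1 : ℤ),
    2 ^ (3 * m + w) - 2 ^ (3 * m - x - y - z : ℤ))]

/-- Four complements. -/
def table4 (m x y z w : ℕ) : List (ℚ × ℚ) :=
  [(0, 1),
   ((2 ^ m - 2 ^ x) * (2 ^ m - 2 ^ z) * (2 ^ m - 2 ^ w) * 2 ^ (m - 1 : ℤ), 2 ^ (m - y : ℤ) - 1),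
   ((2 ^ m - 2 ^ x) * (2 ^ m - 2 ^ y) * (2 ^ m - 2 ^ w) * 2 ^ (m - 1 : ℤ), 2 ^ (m - z : ℤ) - 1),
   ((2 ^ m - 2 ^ x) * (2 ^ m - 2 ^ y) * (2 ^ m - 2 ^ z) * 2 ^ (m - 1 : ℤ), 2 ^ (m - w : ℤ) - 1),
   ((2 ^ m - 2 ^ y) * (2 ^ m - 2 ^ z) * (2 ^ m - 2 ^ w) * 2 ^ (m - 1 : ℤ), 2 ^ (m - x : ℤ) - 1),
   ((2 ^ m - 2 ^ x) * (2 ^ m - 2 ^ w) * (2 ^ m - 2 ^ y - 2 ^ z) * 2 ^ (m - 1 : ℤ),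
    2 ^ (2 * m - y - z : ℤ) - 2 ^ (m - y : ℤ) - 2 ^ (m - z : ℤ) + 1),
   ((2 ^ m - 2 ^ x) * (2 ^ m - 2 ^ z) * (2 ^ m - 2 ^ y - 2 ^ w) * 2 ^ (m - 1 : ℤ),
    2 ^ (2 * m - y - w : ℤ) - 2 ^ (m - y : ℤ) - 2 ^ (m - w : ℤ) + 1),
   ((2 ^ m - 2 ^ x) * (2 ^ m - 2 ^ y) * (2 ^ m - 2 ^ z - 2 ^ w) * 2 ^ (m - 1 : ℤ),
    2 ^ (2 * m - z - w : ℤ) - 2 ^ (m - z : ℤ) - 2 ^ (m - w : ℤ) + 1),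
   ((2 ^ m - 2 ^ z) * (2 ^ m - 2 ^ w) * (2 ^ m - 2 ^ x - 2 ^ y) * 2 ^ (m - 1 : ℤ),
    2 ^ (2 * m - x - y : ℤ) - 2 ^ (m - x : ℤ) - 2 ^ (m - y : ℤ) + 1),
   ((2 ^ m - 2 ^ y) * (2 ^ m - 2 ^ w) * (2 ^ m - 2 ^ x - 2 ^ z) * 2 ^ (m - 1 : ℤ),
    2 ^ (2 * m - x - z : ℤ) - 2 ^ (m - x : ℤ) - 2 ^ (m - z : ℤ) + 1),
   ((2 ^ m - 2 ^ y) * (2 ^ m - 2 ^ z) * (2 ^ m - 2 ^ x - 2 ^ w) * 2 ^ (m - 1 : ℤ),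
    2 ^ (2 * m - x - w : ℤ) - 2 ^ (m - x : ℤ) - 2 ^ (m - w : ℤ) + 1),
   ((2 ^ m - 2 ^ x) * (2 ^ (2 * m) - 2 ^ (m + z) - 2 ^ (m + w) - 2 ^ (m + y)
      + 2 ^ (z + w) + 2 ^ (y + z) + 2 ^ (y + w)) * 2 ^ (m - 1 : ℤ),
    2 ^ (3 * m - y - z - w : ℤ)
      - 2 ^ (2 * m - y - w : ℤ) - 2 ^ (2 * m - y - z : ℤ) - 2 ^ (2 * m - z - w : ℤ)
      + 2 ^ (m - y : ℤ) + 2 ^ (m - w : ℤ) + 2 ^ (m - z : ℤ) - 1),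
   ((2 ^ m - 2 ^ w) * (2 ^ (2 * m) - 2 ^ (m + x) - 2 ^ (m + y) - 2 ^ (m + z)
      + 2 ^ (x + y) + 2 ^ (y + z) + 2 ^ (x + z)) * 2 ^ (m - 1 : ℤ),
    2 ^ (3 * m - x - y - z : ℤ)
      - 2 ^ (2 * m - x - y : ℤ) - 2 ^ (2 * m - y - z : ℤ) - 2 ^ (2 * m - x - z : ℤ)
      + 2 ^ (m - x : ℤ) + 2 ^ (m - y : ℤ) + 2 ^ (m - z : ℤ) - 1),
   ((2 ^ m - 2 ^ z) * (2 ^ (2 * m) - 2 ^ (m + x) - 2 ^ (m + y) - 2 ^ (m + w)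
      + 2 ^ (x + y) + 2 ^ (x + w) + 2 ^ (y + w)) * 2 ^ (m - 1 : ℤ),
    2 ^ (3 * m - x - y - w : ℤ)
      - 2 ^ (2 * m - x - y : ℤ) - 2 ^ (2 * m - y - w : ℤ) - 2 ^ (2 * m - x - w : ℤ)
      + 2 ^ (m - x : ℤ) + 2 ^ (m - y : ℤ) + 2 ^ (m - w : ℤ) - 1),
   ((2 ^ m - 2 ^ y) * (2 ^ (2 * m) - 2 ^ (m + x) - 2 ^ (m + z) - 2 ^ (m + w)
      + 2 ^ (x + z) + 2 ^ (x + w) + 2 ^ (z + w)) * 2 ^ (m - 1 : ℤ),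
    2 ^ (3 * m - x - z - w : ℤ)
      - 2 ^ (2 * m - x - z : ℤ) - 2 ^ (2 * m - z - w : ℤ) - 2 ^ (2 * m - x - w : ℤ)
      + 2 ^ (m - x : ℤ) + 2 ^ (m - z : ℤ) + 2 ^ (m - w : ℤ) - 1),
   ((2 ^ (3 * m) - 2 ^ (2 * m + z) - 2 ^ (2 * m + w) - 2 ^ (2 * m + x) - 2 ^ (2 * m + y)
      + 2 ^ (m + z + w) + 2 ^ (m + x + z) + 2 ^ (m + x + w)
      + 2 ^ (m + z + y) + 2 ^ (m + y + w) + 2 ^ (m + x + y)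
      - 2 ^ (x + z + w) - 2 ^ (y + z + w) - 2 ^ (x + y + z) - 2 ^ (x + y + w)) * 2 ^ (m - 1 : ℤ),
    2 ^ (4 * m - x - y - z - w : ℤ)
      - 2 ^ (3 * m - x - y - z : ℤ) - 2 ^ (3 * m - y - z - w : ℤ)
      - 2 ^ (3 * m - x - z - w : ℤ) - 2 ^ (3 * m - x - y - w : ℤ)
      + 2 ^ (2 * m - y - z : ℤ) + 2 ^ (2 * m - x - z : ℤ) + 2 ^ (2 * m - z - w : ℤ)
      + 2 ^ (2 * m - x - y : ℤ) + 2 ^ (2 * m - y - w : ℤ) + 2 ^ (2 * m - x - w : ℤ)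
      - 2 ^ (m - x : ℤ) - 2 ^ (m - y : ℤ) - 2 ^ (m - z : ℤ) - 2 ^ (m - w : ℤ) + 1),
   ((2 ^ m - 2 ^ x) * (2 ^ m - 2 ^ y) * (2 ^ m - 2 ^ z) * (2 ^ m - 2 ^ w) * 2 ^ (-1 : ℤ),
    2 ^ (4 * m) - 2 ^ (4 * m - x - y - z - w : ℤ))]

/-- Complement of the whole set. -/
def tableCompl (m x y z w : ℕ) : List (ℚ × ℚ) :=
  [(0, 1),
   (2 ^ (4 * m - 1 : ℤ), 2 ^ (4 * m - x - y - z - w : ℤ) - 1),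
   (2 ^ (4 * m - 1 : ℤ) - 2 ^ (x + y + z + w - 1 : ℤ),
    2 ^ (4 * m) - 2 ^ (4 * m - x - y - z - w : ℤ))]

end SubfieldCode

open SubfieldCode

/-! Coordinates in the basis `bvec` identify vectors over the ring with quadruples of binary
vectors, and the subfield code of `D` consists of the words `d ↦ a₁·d₁ + a₂·d₂ + a₃·d₃ + a₄·d₄`
(`binaryCode_eq_range`). The weight of such a word is half of `|D|` minus a sum of signs over `D`,
and for a product set this sum factors into four character sums, one for each slot (`sum_wordSgn`).

The character sum of `Δ_X` at `a` is `2^|X|` if `a` vanishes on `X`, and `0` otherwise. For the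
complement of `Δ_X` it is therefore `2^m - 2^|X|` at `a = 0`, `-2^|X|` at the `2^(m-|X|) - 1` other
vectors vanishing on `X`, and `0` elsewhere. Let `N = |D|` and `ρ = 2^x / (2^m - 2^x)` (`ratio`). If
every factor is non-zero and `T` is the set of complemented slots with `aᵢ ≠ 0`, the weight is `N/2
* (1 - ∏_{i ∈ T} (-ρᵢ))`; if some factor is zero, the weight is `N/2`. Counting the quadruples `a`
and dividing by the size of the kernel of `a ↦ word` gives the frequencies. The complement of a
whole product set behaves like one complemented slot of dimension `4m`.

Since `(-ρ)⁻¹ = 1 - 2^(m-x)`, a congruence modulo a power of two shows that different `T` give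
different weights (`prod_one_sub_two_pow_injective`). As `ρ ≤ 1`, and only non-empty `T` of even
size push the weight below `N/2`, the minimum comes from the pair with the two largest exponents, or
is `N/2` if there is no pair (`signedRatio_le`).

Optimality follows from the Griesmer bound, proved through residual codes (`griesmer_on`), by
evaluating or estimating its sum when `d` or `d + 1` is a signed sum of a few powers of two. -/

namespace SubfieldCode

/-! ### The Griesmer bound and its sums for special minimum distances. -/

section Griesmer

/-- Nested ceilings collapse, `(d + 1) / 2` being `⌈d / 2⌉`. This makes the Griesmer sum of a
residual code the tail of the original sum. -/
theorem ceil_half_div_two_pow (d i : ℕ) :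
    ⌈(((d + 1) / 2 : ℕ) : ℚ) / 2 ^ i⌉₊ = ⌈(d : ℚ) / 2 ^ (i + 1)⌉₊ := by
  apply eq_of_forall_ge_iff
  intro n
  have h : (0 : ℚ) < 2 ^ i := by positivity
  rw [Nat.ceil_le, Nat.ceil_le, div_le_iff₀ h, div_le_iff₀ (by positivity)]
  have e1 : ((((d + 1) / 2 : ℕ) : ℚ) ≤ n * 2 ^ i) ↔ (d + 1) / 2 ≤ n * 2 ^ i := by
    exact_mod_cast Iff.rfl
  have e2 : ((d : ℚ) ≤ n * 2 ^ (i + 1)) ↔ d ≤ n * 2 ^ (i + 1) := by exact_mod_cast Iff.rfl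
  rw [e1, e2, pow_succ, ← mul_assoc]
  omega

theorem sum_ceil_succ (d k : ℕ) :
    ∑ i ∈ Finset.range (k + 1), ⌈(d : ℚ) / 2 ^ i⌉₊ =
      (∑ i ∈ Finset.range k, ⌈(((d + 1) / 2 : ℕ) : ℚ) / 2 ^ i⌉₊) + d := by
  rw [Finset.sum_range_succ']
  simp [ceil_half_div_two_pow]

/-- The Griesmer bound for a linear family of words, weights being counted on a set `S` of
coordinates. -/
theorem griesmer_on {ι : Type*} (k : ℕ) :
    ∀ {V : Type} [AddCommGroup V] [Module (ZMod 2) V] [Finite V]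
      (f : V →ₗ[ZMod 2] (ι → ZMod 2)) (S : Finset ι) (d : ℕ),
      Module.finrank (ZMod 2) V = k →
      (∀ v, v ≠ 0 → d ≤ (S.filter fun i => f v i ≠ 0).card) →
      ∑ i ∈ Finset.range k, ⌈(d : ℚ) / 2 ^ i⌉₊ ≤ S.card := by
  induction k with
  | zero => intros; simp
  | succ k ih =>
    intro V _ _ _ f S d hk hd
    have hnt : Nontrivial V := Module.nontrivial_of_finrank_pos (R := ZMod 2) (by omega)
    -- Residual code: take a word `v` of least weight, keep only the coordinates where it vanishes,
    -- and pass to a complement of the line spanned by `v`.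
    obtain ⟨v, hv, hmin⟩ := Set.exists_min_image {v : V | v ≠ 0}
      (fun v => (S.filter fun i => f v i ≠ 0).card) (Set.toFinite _) (exists_ne 0)
    set w := (S.filter fun i => f v i ≠ 0).card with hw
    set S' := S.filter fun i => f v i = 0 with hS'
    have hcard : S.card = w + S'.card := by
      rw [hw, hS', add_comm]
      exact (Finset.card_filter_add_card_filter_not (s := S) (fun i => f v i = 0)).symm
    obtain ⟨V', hV'⟩ := Submodule.exists_isCompl (Submodule.span (ZMod 2) {v})
    have hfr : Module.finrank (ZMod 2) V' = k := by
      have := Submodule.finrank_add_eq_of_isCompl hV'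
      rw [finrank_span_singleton hv] at this
      omega
    have hres : ∀ v' : V', v' ≠ 0 →
        (d + 1) / 2 ≤ (S'.filter fun i => (f ∘ₗ V'.subtype) v' i ≠ 0).card := by
      intro v' hv'
      have h0 : (v' : V) ≠ 0 := by simpa using hv'
      have h1 : v + (v' : V) ≠ 0 := by
        intro h
        have : v ∈ V' := by
          rw [eq_neg_of_add_eq_zero_left h]
          exact V'.neg_mem v'.2
        exact hv (Submodule.disjoint_def.1 hV'.disjoint v (Submodule.mem_span_singleton_self v)
          this)
      have m0 := hmin _ h0
      have m1 := hmin _ h1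
      have hdw := hd v hv
      change (d + 1) / 2 ≤ (S'.filter fun i => f v' i ≠ 0).card
      set q := (S.filter fun i => f v i ≠ 0 ∧ f v' i ≠ 0).card with hq
      set p := (S'.filter fun i => f v' i ≠ 0).card with hp
      have c0 : (S.filter fun i => f v' i ≠ 0).card = p + q := by
        rw [← Finset.card_filter_add_card_filter_not (fun i => f v i = 0), hp, hq, hS']
        simp only [Finset.filter_filter, and_comm, ne_eq]
      have c1 : w = q + (S.filter fun i => f v i ≠ 0 ∧ f v' i = 0).card := by
        rw [hw, ← Finset.card_filter_add_card_filter_not (fun i => f v' i = 0), hq, add_comm]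
        simp only [Finset.filter_filter, ne_eq]
      have c2 : (S.filter fun i => f (v + v') i ≠ 0).card =
          p + (S.filter fun i => f v i ≠ 0 ∧ f v' i = 0).card := by
        rw [← Finset.card_filter_add_card_filter_not (fun i => f v i = 0), hp, hS']
        simp only [Finset.filter_filter]
        congr 2 <;> ext i <;> simp only [Finset.mem_filter, map_add, Pi.add_apply] <;>
          generalize f v i = a <;> generalize f v' i = b <;> revert a b <;>
          intro a b <;> congr! 1 <;> revert a b <;> decide
      -- Minimality of `v` gives `w ≤ p + q` for `v'` and `w ≤ p + (w - q)` for `v + v'`. Adding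
      -- these yields `2 * p ≥ w ≥ d`.
      omega
    have := ih (f ∘ₗ V'.subtype) S' ((d + 1) / 2) hfr hres
    rw [sum_ceil_succ, hcard]
    have := hd v hv
    omega

theorem minDist_le {ι : Type*} [Fintype ι] (C : Submodule (ZMod 2) (ι → ZMod 2)) {c : ι → ZMod 2}
    (hc : c ∈ C) (h0 : c ≠ 0) : minDist C ≤ hammingNorm c :=
  Nat.sInf_le ⟨c, hc, h0, rfl⟩

theorem griesmer_bound {n : ℕ} (C : Submodule (ZMod 2) (Fin n → ZMod 2)) :
    ∑ i ∈ Finset.range (dimension C), ⌈(minDist C : ℚ) / 2 ^ i⌉₊ ≤ n := by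
  have := griesmer_on (dimension C) C.subtype Finset.univ (minDist C) rfl
    (fun v hv => minDist_le C v.2 (by simpa using hv))
  simpa using this

theorem isDistanceOptimal_of_lt {ι : Type*} [Fintype ι] (C : Submodule (ZMod 2) (ι → ZMod 2))
    (h : length C < ∑ i ∈ Finset.range (dimension C), ⌈((minDist C + 1 : ℕ) : ℚ) / 2 ^ i⌉₊) :
    IsDistanceOptimal C := by
  rintro ⟨C', hk, hd⟩
  have := griesmer_bound C'
  rw [hk, hd] at this
  omega

/-- Raising `d` by one lowers no term of the Griesmer sum and raises the term `i = 0`, which is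
present because the dimension is positive. -/
theorem AttainsGriesmer.isDistanceOptimal {ι : Type*} [Fintype ι]
    {C : Submodule (ZMod 2) (ι → ZMod 2)} (h : AttainsGriesmer C) (hk : 0 < dimension C) :
    IsDistanceOptimal C := by
  apply isDistanceOptimal_of_lt
  rw [AttainsGriesmer] at h
  rw [h]
  refine Finset.sum_lt_sum (fun i _ => ?_) ⟨0, by simpa using hk, by simp [Nat.lt_ceil]⟩
  gcongr
  simp

theorem sum_two_pow_sub (K : ℕ) : ∑ i ∈ Finset.range K, (2 : ℚ) ^ (K - 1 - i) = 2 ^ K - 1 := by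
  rw [Finset.sum_range_reflect (fun i => (2 : ℚ) ^ i), geom_sum_eq (by norm_num)]
  norm_num

theorem sum_two_pow_div (a K : ℕ) (h : a < K) :
    ∑ i ∈ Finset.range K, 2 ^ a / 2 ^ i = 2 ^ (a + 1) - 1 := by
  obtain ⟨r, rfl⟩ := Nat.exists_eq_add_of_lt h
  rw [show a + r + 1 = (a + 1) + r by ring, Finset.sum_range_add]
  have h1 : ∑ i ∈ Finset.range (a + 1), 2 ^ a / 2 ^ i = ∑ i ∈ Finset.range (a + 1), 2 ^ i := by
    rw [← Finset.sum_range_reflect]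
    refine Finset.sum_congr rfl fun i hi => ?_
    rw [Finset.mem_range] at hi
    rw [Nat.pow_div (by omega) (by norm_num)]
    congr 1
    omega
  have h2 : ∑ i ∈ Finset.range r, 2 ^ a / 2 ^ (a + 1 + i) = 0 := by
    refine Finset.sum_eq_zero fun i _ => Nat.div_eq_of_lt ?_
    exact Nat.pow_lt_pow_right (by norm_num) (by omega)
  rw [h1, h2, Nat.geomSum_eq le_rfl]
  simp

/-- Division with remainder by a power of two, over the rationals. -/
theorem two_pow_div_cast (a i : ℕ) :
    (2 : ℚ) ^ a = 2 ^ i * ((2 ^ a / 2 ^ i : ℕ) : ℚ) + (if i ≤ a then 0 else 2 ^ a) := by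
  split_ifs with h
  · rw [Nat.pow_div h (by norm_num)]
    push_cast
    rw [add_zero, ← pow_add]
    congr 1
    omega
  · rw [Nat.div_eq_of_lt (Nat.pow_lt_pow_right (by norm_num) (by omega))]
    simp

/-- The Griesmer sum of `2 ^ (K - 1) - 2 ^ a` is `2 ^ K - 2 ^ (a + 1)`. -/
theorem sum_ceil_two_pow_sub (K a d : ℕ) (h : a + 1 < K) (hd : (d : ℚ) = 2 ^ (K - 1) - 2 ^ a) :
    ((∑ i ∈ Finset.range K, ⌈(d : ℚ) / 2 ^ i⌉₊ : ℕ) : ℚ) = 2 ^ K - 2 ^ (a + 1) := by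
  have key : ∀ i ∈ Finset.range K,
      ((⌈(d : ℚ) / 2 ^ i⌉₊ : ℕ) : ℚ) = 2 ^ (K - 1 - i) - ((2 ^ a / 2 ^ i : ℕ) : ℚ) := by
    intro i hi
    rw [Finset.mem_range] at hi
    have hle : 2 ^ a / 2 ^ i ≤ 2 ^ (K - 1 - i) := by
      rw [← Nat.pow_div (show i ≤ K - 1 by omega) (by norm_num)]
      exact Nat.div_le_div_right (Nat.pow_le_pow_right (by norm_num) (by omega))
    have hp : (2 : ℚ) ^ (K - 1) = 2 ^ i * 2 ^ (K - 1 - i) := by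
      rw [← pow_add]; congr 1; omega
    have hpos : (0 : ℚ) < 2 ^ i := by positivity
    have : ⌈(d : ℚ) / 2 ^ i⌉₊ = 2 ^ (K - 1 - i) - 2 ^ a / 2 ^ i := by
      have hlt : 2 ^ a / 2 ^ i < 2 ^ (K - 1 - i) := by
        rw [← Nat.pow_div (show i ≤ K - 1 by omega) (by norm_num)]
        apply Nat.div_lt_div_of_lt_of_dvd
        · exact pow_dvd_pow _ (by omega)
        · exact Nat.pow_lt_pow_right (by norm_num) (by omega)
      rw [Nat.ceil_eq_iff (Nat.sub_pos_of_lt hlt).ne']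
      have hcast : ((2 ^ (K - 1 - i) - 2 ^ a / 2 ^ i : ℕ) : ℚ) =
          2 ^ (K - 1 - i) - ((2 ^ a / 2 ^ i : ℕ) : ℚ) := by
        rw [Nat.cast_sub hle]; push_cast; rfl
      rw [Nat.cast_sub (Nat.sub_pos_of_lt hlt), hcast, lt_div_iff₀ hpos, div_le_iff₀ hpos, hd, hp,
        two_pow_div_cast a i]
      -- The remainder of `2 ^ a` modulo `2 ^ i` is below `2 ^ i`, so the ceiling of the difference
      -- subtracts exactly the floor of `2 ^ a / 2 ^ i`.
      have : (if i ≤ a then (0 : ℚ) else 2 ^ a) < 2 ^ i := by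
        split_ifs with h
        · positivity
        · exact pow_lt_pow_right₀ (by norm_num) (by omega)
      have : (0 : ℚ) ≤ (if i ≤ a then (0 : ℚ) else 2 ^ a) := by positivity
      constructor <;> push_cast <;> nlinarith
    rw [this, Nat.cast_sub hle]
    push_cast
    rfl
  rw [Nat.cast_sum, Finset.sum_congr rfl key, Finset.sum_sub_distrib, sum_two_pow_sub,
    ← Nat.cast_sum, sum_two_pow_div a K (by omega), Nat.cast_sub Nat.one_le_two_pow]
  push_cast
  ring

/-- Each of the `K` terms is at least `2 ^ (K - 1 - i) + 1`, so the sum is at least `2 ^ K - 1 + K`.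
For `K = 1` the two sides would be equal. -/
theorem lt_sum_ceil_two_pow_add_one (K : ℕ) (h : 2 ≤ K) :
    2 ^ K < ∑ i ∈ Finset.range K, ⌈((2 ^ (K - 1) + 1 : ℕ) : ℚ) / 2 ^ i⌉₊ := by
  have key : ∀ i ∈ Finset.range K,
      (2 : ℚ) ^ (K - 1 - i) + 1 ≤ ((⌈((2 ^ (K - 1) + 1 : ℕ) : ℚ) / 2 ^ i⌉₊ : ℕ) : ℚ) := by
    intro i hi
    rw [Finset.mem_range] at hi
    have hp : (2 : ℚ) ^ (K - 1) = 2 ^ i * 2 ^ (K - 1 - i) := by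
      rw [← pow_add]; congr 1; omega
    have hpos : (0 : ℚ) < 2 ^ i := by positivity
    have : 2 ^ (K - 1 - i) < ⌈((2 ^ (K - 1) + 1 : ℕ) : ℚ) / 2 ^ i⌉₊ := by
      rw [Nat.lt_ceil, lt_div_iff₀ hpos]
      push_cast
      rw [hp]
      linarith
    exact_mod_cast this
  have := Finset.sum_le_sum key
  rw [Finset.sum_add_distrib, sum_two_pow_sub, ← Nat.cast_sum] at this
  simp only [Finset.sum_const, Finset.card_range, nsmul_eq_mul, mul_one] at this
  have h2 : (2 : ℚ) ≤ K := by exact_mod_cast h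
  have : (2 : ℚ) ^ K < ((∑ i ∈ Finset.range K, ⌈((2 ^ (K - 1) + 1 : ℕ) : ℚ) / 2 ^ i⌉₊ : ℕ) : ℚ) := by
    linarith
  exact_mod_cast this

/-- For `i ≤ a` the number `(d - 1) / 2 ^ i` is an integer, and the extra `1` in `d` pushes the
ceiling to the next one. These `a + 1` gains produce the summand `a` on the left. -/
theorem le_sum_ceil_two_pow_sub_sub (K a b d : ℕ) (hab : a < b) (hb : b < K)
    (hd : (d : ℚ) = 2 ^ (K - 1) - 2 ^ a - 2 ^ b + 1) :
    (2 : ℚ) ^ K - 2 ^ (a + 1) - 2 ^ (b + 1) + 2 + a ≤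
      ((∑ i ∈ Finset.range K, ⌈(d : ℚ) / 2 ^ i⌉₊ : ℕ) : ℚ) := by
  have key : ∀ i ∈ Finset.range K,
      (2 : ℚ) ^ (K - 1 - i) - ((2 ^ a / 2 ^ i : ℕ) : ℚ) - ((2 ^ b / 2 ^ i : ℕ) : ℚ)
        + (if i < a + 1 then 1 else 0) ≤ ((⌈(d : ℚ) / 2 ^ i⌉₊ : ℕ) : ℚ) := by
    intro i hi
    rw [Finset.mem_range] at hi
    have hp : (2 : ℚ) ^ (K - 1) = 2 ^ i * 2 ^ (K - 1 - i) := by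
      rw [← pow_add]; congr 1; omega
    have hpos : (0 : ℚ) < 2 ^ i := by positivity
    have ha' := two_pow_div_cast a i
    have hb' := two_pow_div_cast b i
    generalize 2 ^ a / 2 ^ i = qa at ha' ⊢
    generalize 2 ^ b / 2 ^ i = qb at hb' ⊢
    set n : ℤ := 2 ^ (K - 1 - i) - (qa : ℤ) - (qb : ℤ)
        + (if i < a + 1 then 1 else 0) with hn
    -- Between integers, `n ≤ ⌈·⌉` is the same as `n - 1 < ⌈·⌉`, which follows from a strict
    -- inequality without the ceiling.
    suffices h : n - 1 < ((⌈(d : ℚ) / 2 ^ i⌉₊ : ℕ) : ℤ) by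
      have h' : n ≤ ((⌈(d : ℚ) / 2 ^ i⌉₊ : ℕ) : ℤ) := by omega
      have h'' : (n : ℚ) ≤ (((⌈(d : ℚ) / 2 ^ i⌉₊ : ℕ) : ℤ) : ℚ) := by exact_mod_cast h'
      rw [hn] at h''
      push_cast at h'' ⊢
      exact h''
    have hlt : ((n : ℚ) - 1) < (d : ℚ) / 2 ^ i := by
      rw [lt_div_iff₀ hpos, hd, hn]
      push_cast
      rw [hp, ha', hb']
      -- A comparison of remainders modulo `2 ^ i`. When both exponents are below `i`, `a < b` keeps
      -- `2 ^ a + 2 ^ b` below `2 ^ i`.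
      have hr : (if i ≤ a then (0 : ℚ) else 2 ^ a) + (if i ≤ b then (0 : ℚ) else 2 ^ b) - 1
          < 2 ^ i - 2 ^ i * (if i < a + 1 then 1 else 0) := by
        split_ifs with h1 h2 h3 h4 h5
        all_goals try omega
        · simp
        · have : (2 : ℚ) ^ a < 2 ^ i := pow_lt_pow_right₀ (by norm_num) (by omega)
          linarith
        · have h1 : (2 : ℚ) ^ (a + 1) ≤ 2 ^ b := pow_le_pow_right₀ (by norm_num) (by omega)
          have h2 : (2 : ℚ) ^ (b + 1) ≤ 2 ^ i := pow_le_pow_right₀ (by norm_num) (by omega)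
          have h3 : (0 : ℚ) < 2 ^ a := by positivity
          rw [pow_succ] at h1 h2
          linarith
      linear_combination hr
    have := hlt.trans_le (Nat.le_ceil _)
    exact_mod_cast this
  have := Finset.sum_le_sum key
  rw [Finset.sum_add_distrib, Finset.sum_sub_distrib, Finset.sum_sub_distrib, sum_two_pow_sub,
    ← Nat.cast_sum, ← Nat.cast_sum, ← Nat.cast_sum, sum_two_pow_div a K (by omega),
    sum_two_pow_div b K hb, Nat.cast_sub Nat.one_le_two_pow, Nat.cast_sub Nat.one_le_two_pow,
    Finset.sum_boole] at this
  have hf : (Finset.range K).filter (fun i => i < a + 1) = Finset.range (a + 1) := by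
    ext i; simp; omega
  rw [hf, Finset.card_range] at this
  push_cast at this ⊢
  linarith

end Griesmer

/-! ### Weight enumerators tested against arbitrary functions of the weight. -/

section Enumerator

variable {ι : Type*} [Fintype ι]

open Classical in
/-- The weight enumerator of `C` is given by the table `T` of pairs (weight, frequency): sums over
`C` of functions of the weight are computed by `T`. -/
def HasWeightEnumerator (C : Submodule (ZMod 2) (ι → ZMod 2)) (T : List (ℚ × ℚ)) : Prop :=
  ∀ g : ℚ → ℚ, ∑ c : ι → ZMod 2 with c ∈ C, g (hammingNorm c) = (T.map fun r => r.2 * g r.1).sum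

variable {C : Submodule (ZMod 2) (ι → ZMod 2)} {T : List (ℚ × ℚ)}

theorem HasWeightEnumerator.hasWeightTable (h : HasWeightEnumerator C T) :
    HasWeightTable C T := by
  classical
  intro j
  have := h fun q => if q = (j : ℚ) then 1 else 0
  simp only [mul_ite, mul_one, mul_zero] at this
  rw [← this, weightCount, Set.ncard_eq_toFinset_card', ← Finset.sum_filter, Finset.sum_const,
    Finset.filter_filter, nsmul_eq_mul, mul_one]
  congr 2
  ext c
  simp

theorem HasWeightEnumerator.two_pow_dimension (h : HasWeightEnumerator C T) :
    (2 : ℚ) ^ dimension C = (T.map Prod.snd).sum := by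
  classical
  have := h fun _ => 1
  simp only [mul_one, Finset.sum_const, nsmul_eq_mul] at this
  rw [← Fintype.card_subtype] at this
  have hc : Fintype.card {c // c ∈ C} = 2 ^ dimension C := by
    have := Module.card_eq_pow_finrank (K := ZMod 2) (V := C)
    rwa [ZMod.card] at this
  rw [hc] at this
  push_cast at this
  exact this

theorem HasWeightEnumerator.dimension_eq (h : HasWeightEnumerator C T) {k : ℕ}
    (hk : (T.map Prod.snd).sum = 2 ^ k) : dimension C = k := by
  have := h.two_pow_dimension.trans hk
  exact Nat.pow_right_injective le_rfl (by exact_mod_cast this)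

theorem HasWeightEnumerator.exists_mem (h : HasWeightEnumerator C T) {c : ι → ZMod 2}
    (hc : c ∈ C) : ∃ r ∈ T, r.1 = hammingNorm c := by
  classical
  by_contra! hne
  have := h fun q => if q = (hammingNorm c : ℚ) then 1 else 0
  have h0 : (T.map fun r => r.2 * if r.1 = (hammingNorm c : ℚ) then 1 else 0).sum = 0 := by
    apply List.sum_eq_zero
    intro q hq
    obtain ⟨r, hr, rfl⟩ := List.mem_map.1 hq
    simp [hne r hr]
  rw [h0, Finset.sum_eq_zero_iff_of_nonneg (fun _ _ => by positivity)] at this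
  simpa using this c (by simpa using hc)

theorem HasWeightEnumerator.exists_codeword (h : HasWeightEnumerator C T)
    (hT : ∀ r ∈ T, 0 < r.2) {r : ℚ × ℚ} (hr : r ∈ T) : ∃ c ∈ C, (hammingNorm c : ℚ) = r.1 := by
  classical
  by_contra! hne
  have := h fun q => if q = r.1 then 1 else 0
  rw [Finset.sum_eq_zero] at this
  -- All frequencies being positive, rows that share the weight `r.1` cannot cancel.
  · have hle : r.2 ≤ (T.map fun r' => r'.2 * if r'.1 = r.1 then 1 else 0).sum := by
      apply List.single_le_sum
      · intro q hq
        obtain ⟨r', hr', rfl⟩ := List.mem_map.1 hq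
        have := hT r' hr'
        positivity
      · exact List.mem_map.2 ⟨r, hr, by simp⟩
    have := hT r hr
    linarith
  · intro c hc
    simp [hne c (by simpa using hc)]

variable {T' : List (ℚ × ℚ)}

theorem HasWeightEnumerator.minDist_eq (h : HasWeightEnumerator C ((0, 1) :: T'))
    (hT : ∀ r ∈ T', 0 < r.1 ∧ 0 < r.2) {d : ℚ} (hd : d ∈ T'.map Prod.fst)
    (hle : ∀ w ∈ T'.map Prod.fst, d ≤ w) : (minDist C : ℚ) = d := by
  have hT0 : ∀ r ∈ ((0, 1) :: T' : List (ℚ × ℚ)), 0 < r.2 := by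
    intro r hr
    rcases List.mem_cons.1 hr with rfl | hr
    · exact one_pos
    · exact (hT r hr).2
  obtain ⟨r, hr, rfl⟩ := List.mem_map.1 hd
  obtain ⟨c, hc, hcr⟩ := h.exists_codeword hT0 (List.mem_cons_of_mem _ hr)
  have hc0 : c ≠ 0 := by
    rintro rfl
    have := (hT r hr).1
    simp [← hcr] at this
  apply le_antisymm
  · rw [← hcr]
    exact_mod_cast minDist_le C hc hc0
  · obtain ⟨c', hc', h0, hw⟩ := Nat.sInf_mem (s := {w : ℕ | ∃ c ∈ C, c ≠ 0 ∧ hammingNorm c = w})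
      ⟨_, c, hc, hc0, rfl⟩
    obtain ⟨r', hr', hw'⟩ := h.exists_mem hc'
    rcases List.mem_cons.1 hr' with rfl | hr'
    · exact absurd (hammingNorm_eq_zero.1 (Nat.cast_eq_zero.1 hw'.symm)) h0
    · rw [minDist, ← hw, ← hw']
      exact hle _ (List.mem_map_of_mem hr')

theorem HasWeightEnumerator.isWeight (h : HasWeightEnumerator C ((0, 1) :: T'))
    (hT : ∀ r ∈ T', 0 < r.1 ∧ 0 < r.2) (hn : (T'.map Prod.fst).Nodup) :
    IsWeight T'.length C := by
  classical
  have hT0 : ∀ r ∈ ((0, 1) :: T' : List (ℚ × ℚ)), 0 < r.2 := by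
    intro r hr
    rcases List.mem_cons.1 hr with rfl | hr
    · exact one_pos
    · exact (hT r hr).2
  have hiff : ∀ j, weightCount C j ≠ 0 ↔ ∃ c ∈ C, hammingNorm c = j := by
    intro j
    rw [weightCount, ← Nat.pos_iff_ne_zero, Set.ncard_pos]
    rfl
  rw [IsWeight, ← List.length_map (f := Prod.fst), ← List.toFinset_card_of_nodup hn]
  apply Finset.card_bij (fun (j : ℕ) _ => (j : ℚ))
  · intro j hj
    rw [Finset.mem_filter, Finset.mem_Icc, hiff] at hj
    obtain ⟨⟨h1, -⟩, c, hc, rfl⟩ := hj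
    obtain ⟨r, hr, hw⟩ := h.exists_mem hc
    rcases List.mem_cons.1 hr with rfl | hr
    · have : hammingNorm c = 0 := Nat.cast_eq_zero.1 hw.symm
      omega
    · rw [List.mem_toFinset, ← hw]
      exact List.mem_map_of_mem hr
  · intro i _ j _ hij
    exact_mod_cast hij
  · intro q hq
    obtain ⟨r, hr, rfl⟩ := List.mem_map.1 (List.mem_toFinset.1 hq)
    obtain ⟨c, hc, hw⟩ := h.exists_codeword hT0 (List.mem_cons_of_mem _ hr)
    refine ⟨hammingNorm c, ?_, hw⟩
    rw [Finset.mem_filter, Finset.mem_Icc, hiff]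
    refine ⟨⟨?_, hammingNorm_le_card_fintype⟩, c, hc, rfl⟩
    have := (hT r hr).1
    rw [← hw] at this
    exact_mod_cast this

end Enumerator

/-! ### Value distributions of functions up to the value zero, and enumerators of images. -/

section Distribution

/-- Apart from the value `0`, the function `s` on the finite type `A` takes the value `v i` with
multiplicity `κ * c i`. -/
def HasDistribution {A I : Type*} [Fintype A] [Fintype I] (s : A → ℚ) (κ : ℚ) (c v : I → ℚ) :
    Prop :=
  ∀ h : ℚ → ℚ, h 0 = 0 → ∑ a, h (s a) = κ * ∑ i, c i * h (v i)

/-- Fixing one factor of the product, `q ↦ h (s a * q)` again vanishes at `0`, so the two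
distributions can be applied in turn. Ignoring the value `0` is what keeps the product free of mixed
rows. -/
theorem HasDistribution.prod {A B I J : Type*} [Fintype A] [Fintype B] [Fintype I] [Fintype J]
    {s : A → ℚ} {t : B → ℚ} {κ μ : ℚ} {c v : I → ℚ} {e w : J → ℚ}
    (hs : HasDistribution s κ c v) (ht : HasDistribution t μ e w) :
    HasDistribution (fun p : A × B => s p.1 * t p.2) (κ * μ)
      (fun q : I × J => c q.1 * e q.2) (fun q : I × J => v q.1 * w q.2) := by
  intro h h0
  simp only [Fintype.sum_prod_type]
  have h1 : ∀ a, ∑ b, h (s a * t b) = μ * ∑ j, e j * h (s a * w j) := fun a =>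
    ht (fun q => h (s a * q)) (by simpa using h0)
  have h2 : ∀ j, ∑ a, h (s a * w j) = κ * ∑ i, c i * h (v i * w j) := fun j =>
    hs (fun q => h (q * w j)) (by simpa using h0)
  simp only [h1, ← Finset.mul_sum]
  rw [Finset.sum_comm]
  simp only [← Finset.mul_sum, h2]
  rw [mul_comm κ μ, mul_assoc]
  congr 1
  rw [Finset.sum_comm]
  simp only [Finset.mul_sum]
  refine Finset.sum_congr rfl fun i _ => Finset.sum_congr rfl fun j _ => ?_
  ring

/-- Of the `κ` places where `s` equals `σ`, one is `0`, where the new value is `τ - σ`; at the other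
`κ - 1` it is `-σ`. This is the passage from a set to its complement for character sums. -/
theorem HasDistribution.compl {A : Type*} [Fintype A] [Zero A] [DecidableEq A]
    {s : A → ℚ} {κ σ : ℚ} (hs : HasDistribution s κ (fun _ : Unit => 1) (fun _ => σ))
    (h0 : s 0 = σ) (τ : ℚ) :
    HasDistribution (fun a => (if a = 0 then τ else 0) - s a) 1
      (fun b : Bool => if b then κ - 1 else 1) (fun b => if b then -σ else τ - σ) := by
  intro h hh
  have h1 := hs (fun q => h (-q)) (by simpa using hh)
  rw [← Finset.add_sum_erase _ _ (Finset.mem_univ (0 : A))] at h1 ⊢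
  have h2 : ∀ a ∈ Finset.univ.erase (0 : A),
      h ((if a = 0 then τ else 0) - s a) = h (-s a) := by
    intro a ha
    simp [Finset.ne_of_mem_erase ha]
  rw [Finset.sum_congr rfl h2]
  simp only [h0, Finset.univ_unique, Finset.sum_const, Finset.card_singleton, one_smul, one_mul,
    if_true, Fintype.sum_bool, Bool.false_eq_true, if_false] at h1 ⊢
  linear_combination h1

/-- All fibres of `φ` over its range have the size of the kernel, so sums over `A` are sums over the
code times that size. -/
theorem hasWeightEnumerator_range {A ι : Type*} [Fintype ι] [AddCommGroup A] [Module (ZMod 2) A]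
    [Fintype A] (φ : A →ₗ[ZMod 2] (ι → ZMod 2)) {κ : ℚ} {T' : List (ℚ × ℚ)}
    (hκ : κ ≠ 0) (hT : ∀ r ∈ T', 0 < r.1)
    (h : ∀ g : ℚ → ℚ, ∑ a, g (hammingNorm (φ a)) =
      κ * (((0, 1) :: T').map fun r : ℚ × ℚ => r.2 * g r.1).sum) :
    HasWeightEnumerator (LinearMap.range φ) ((0, 1) :: T') := by
  classical
  have hsum : ∀ g : ℚ → ℚ, ∑ a, g (hammingNorm (φ a)) =
      (Finset.univ.filter fun a => φ a = 0).card *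
        ∑ c : ι → ZMod 2 with c ∈ LinearMap.range φ, g (hammingNorm c) := by
    intro g
    rw [Finset.mul_sum, ← Finset.sum_fiberwise_of_maps_to (s := Finset.univ)
      (t := Finset.univ.filter fun c => c ∈ LinearMap.range φ) (g := φ) (by simp)]
    refine Finset.sum_congr rfl fun c hc => ?_
    rw [Finset.sum_congr rfl (g := fun _ => g (hammingNorm c))
      (fun a ha => by rw [(Finset.mem_filter.1 ha).2]), Finset.sum_const, nsmul_eq_mul]
    congr 2
    obtain ⟨a, rfl⟩ := (Finset.mem_filter.1 hc).2
    exact AddMonoidHom.card_fiber_eq_of_mem_range φ.toAddMonoidHom ⟨a, rfl⟩ ⟨0, map_zero φ⟩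
  -- Testing on the indicator of weight `0` isolates the row `(0, 1)`, because all other listed
  -- weights are positive.
  have hker : ((Finset.univ.filter fun a => φ a = 0).card : ℚ) = κ := by
    have := h fun q => if q = 0 then 1 else 0
    have hz : (T'.map fun r : ℚ × ℚ => r.2 * if r.1 = 0 then (1 : ℚ) else 0).sum = 0 := by
      apply List.sum_eq_zero
      intro q hq
      obtain ⟨r, hr, rfl⟩ := List.mem_map.1 hq
      simp [(hT r hr).ne']
    rw [List.map_cons, List.sum_cons, hz, ← Finset.sum_filter] at this
    simpa using this
  intro g
  have := h g
  rw [hsum, hker] at this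
  exact mul_left_cancel₀ hκ this

/-- The value `0` of `s` corresponds to the weight `N / 2`. Testing on `g ((N - q) / 2) - g (N /
2)`, which vanishes at `q = 0`, leaves these words to be counted through the total `K` of codewords.
-/
theorem HasDistribution.hasWeightEnumerator {A I ι : Type*} [Fintype ι] [AddCommGroup A]
    [Module (ZMod 2) A] [Fintype A] [Fintype I] {φ : A →ₗ[ZMod 2] (ι → ZMod 2)} {s : A → ℚ}
    {κ N K : ℚ} {c v : I → ℚ} {T' : List (ℚ × ℚ)} (hs : HasDistribution s κ c v)
    (hφ : ∀ a, (hammingNorm (φ a) : ℚ) = (N - s a) / 2) (hκ : κ ≠ 0)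
    (hcard : (Fintype.card A : ℚ) = κ * K) (hT : ∀ r ∈ T', 0 < r.1)
    (h : ∀ g : ℚ → ℚ, ∑ i, c i * (g ((N - v i) / 2) - g (N / 2)) + K * g (N / 2) =
      (((0, 1) :: T').map fun r : ℚ × ℚ => r.2 * g r.1).sum) :
    HasWeightEnumerator (LinearMap.range φ) ((0, 1) :: T') := by
  refine hasWeightEnumerator_range φ hκ hT fun g => ?_
  have := hs (fun q => g ((N - q) / 2) - g (N / 2)) (by simp)
  rw [Finset.sum_sub_distrib, Finset.sum_const, Finset.card_univ, nsmul_eq_mul, hcard] at this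
  simp only [hφ, ← h]
  linear_combination this

end Distribution

/-! ### Character sums of simplicial complexes and of their complements. -/

section Characters

/-- The non-trivial additive character of `𝔽₂`. -/
def sgn (t : ZMod 2) : ℚ := if t = 0 then 1 else -1

theorem sgn_zero : sgn 0 = 1 := if_pos rfl

theorem sgn_one : sgn 1 = -1 := if_neg one_ne_zero

theorem sgn_add (s t : ZMod 2) : sgn (s + t) = sgn s * sgn t := by
  have h : ∀ b : ZMod 2, b = 0 ∨ b = 1 := by decide
  rcases h s with rfl | rfl <;> rcases h t with rfl | rfl <;>
    simp [sgn_zero, sgn_one, CharTwo.add_self_eq_zero]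

theorem sgn_sum {ι : Type*} (s : Finset ι) (f : ι → ZMod 2) :
    sgn (∑ i ∈ s, f i) = ∏ i ∈ s, sgn (f i) := by
  classical
  induction s using Finset.induction_on with
  | empty => simp [sgn_zero]
  | insert i s hi ih => rw [Finset.sum_insert hi, Finset.prod_insert hi, sgn_add, ih]

theorem hammingNorm_eq_sum_sgn {ι : Type*} [Fintype ι] (c : ι → ZMod 2) :
    (hammingNorm c : ℚ) = (Fintype.card ι - ∑ i, sgn (c i)) / 2 := by
  have h : ∀ i, sgn (c i) = 1 - 2 * (if c i ≠ 0 then 1 else 0) := by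
    intro i
    by_cases hi : c i = 0 <;> simp [sgn, hi]
    norm_num
  simp only [h, Finset.sum_sub_distrib, ← Finset.mul_sum, Finset.sum_boole, hammingNorm]
  simp

variable {m : ℕ}

/-- The sum over `S` of the character attached to `a`. -/
def charSum (S : Finset (Fin m → ZMod 2)) (a : Fin m → ZMod 2) : ℚ := ∑ t ∈ S, sgn (a ⬝ᵥ t)

theorem charSum_zero (S : Finset (Fin m → ZMod 2)) : charSum S 0 = S.card := by
  simp [charSum, sgn_zero]

theorem simplicial_eq_piFinset (X : Finset (Fin m)) :
    simplicial X = Fintype.piFinset fun i => if i ∈ X then Finset.univ else {0} := by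
  ext t
  simp only [simplicial, Finset.mem_filter, Finset.mem_univ, true_and, Fintype.mem_piFinset]
  refine forall_congr' fun i => ?_
  by_cases hi : i ∈ X <;> simp [hi]

/-- The sum over a box factors over coordinates: a coordinate in `X` contributes `1 + sgn (a i)`,
which is `2` or `0`, and any other coordinate contributes `1`. -/
theorem charSum_simplicial (X : Finset (Fin m)) (a : Fin m → ZMod 2) :
    charSum (simplicial X) a = if ∀ i ∈ X, a i = 0 then 2 ^ X.card else 0 := by
  have h1 : ∀ i, ∑ t ∈ (if i ∈ X then Finset.univ else {0} : Finset (ZMod 2)), sgn (a i * t) =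
      if i ∈ X then (if a i = 0 then 2 else 0) else 1 := by
    intro i
    by_cases hi : i ∈ X
    · simp only [hi, if_true]
      have h : a i = 0 ∨ a i = 1 := by
        generalize a i = b
        revert b
        decide
      refine (Fin.sum_univ_two (fun t : ZMod 2 => sgn (a i * t))).trans ?_
      change sgn (a i * 0) + sgn (a i * 1) = _
      rcases h with h | h <;> norm_num [h, sgn_zero, sgn_one]
    · simp [hi, sgn_zero]
  simp only [charSum, dotProduct, sgn_sum]
  rw [simplicial_eq_piFinset, ← Finset.prod_univ_sum
    (fun i => if i ∈ X then Finset.univ else ({0} : Finset (ZMod 2))) (fun i t => sgn (a i * t)),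
    Finset.prod_congr rfl fun i _ => h1 i,
    Finset.prod_ite_mem, Finset.univ_inter]
  split_ifs with h
  · rw [Finset.prod_congr rfl fun i hi => if_pos (h i hi), Finset.prod_const]
  · push Not at h
    obtain ⟨i, hi, hne⟩ := h
    exact Finset.prod_eq_zero hi (if_neg hne)

theorem card_simplicial (X : Finset (Fin m)) : (simplicial X).card = 2 ^ X.card := by
  have := charSum_simplicial X 0
  rw [charSum_zero] at this
  exact_mod_cast this.trans (if_pos fun _ _ => rfl)

theorem simplicial_univ : simplicial (Finset.univ : Finset (Fin m)) = Finset.univ := by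
  ext t
  simp [simplicial]

theorem charSum_univ (a : Fin m → ZMod 2) :
    charSum Finset.univ a = if a = 0 then 2 ^ m else 0 := by
  rw [← simplicial_univ, charSum_simplicial]
  simp [funext_iff]

theorem charSum_compl (S : Finset (Fin m → ZMod 2)) (a : Fin m → ZMod 2) :
    charSum Sᶜ a = (if a = 0 then 2 ^ m else 0) - charSum S a := by
  rw [← charSum_univ, charSum, charSum, charSum, ← Finset.sum_add_sum_compl S]
  ring

/-- The vectors vanishing on `X` form the complex of `Xᶜ`, of size `2 ^ (m - X.card)`. -/
theorem hasDistribution_charSum_simplicial (X : Finset (Fin m)) :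
    HasDistribution (charSum (simplicial X)) (2 ^ m / 2 ^ X.card) (fun _ : Unit => 1)
      (fun _ => 2 ^ X.card) := by
  intro h h0
  have h1 : ∀ a, h (charSum (simplicial X) a) =
      if a ∈ simplicial Xᶜ then h (2 ^ X.card) else 0 := by
    intro a
    have : a ∈ simplicial Xᶜ ↔ ∀ i ∈ X, a i = 0 := by
      simp only [simplicial, Finset.mem_filter, Finset.mem_univ, true_and, Finset.mem_compl]
      exact forall_congr' fun i => by tauto
    rw [charSum_simplicial, apply_ite h, h0]
    simp only [this]
  rw [Finset.sum_congr rfl fun a _ => h1 a, Finset.sum_ite_mem, Finset.univ_inter,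
    Finset.sum_const, card_simplicial, Finset.card_compl, Fintype.card_fin, nsmul_eq_mul]
  push_cast
  rw [pow_sub₀ _ two_ne_zero (by simpa using X.card_le_univ)]
  simp [div_eq_mul_inv]

theorem hasDistribution_charSum_compl (X : Finset (Fin m)) :
    HasDistribution (charSum (simplicial X)ᶜ) 1
      (fun b : Bool => if b then 2 ^ m / 2 ^ X.card - 1 else 1)
      (fun b => if b then -2 ^ X.card else 2 ^ m - 2 ^ X.card) := by
  have := (hasDistribution_charSum_simplicial X).compl (by simp [charSum_simplicial]) (2 ^ m)
  simpa only [← charSum_compl] using this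

end Characters

/-! ### The subfield code as the image of a linear map, and its weights as character sums. -/

section Words

variable {m : ℕ}

/-- The `j`-th coordinate vector of a vector over the ring. -/
noncomputable def coordVec (j : Fin 4) (d : Fin m → Rng) : Fin m → ZMod 2 :=
  fun i => bBasis.repr (d i) j

/-- The codeword `d ↦ a₁ · d₁ + a₂ · d₂ + a₃ · d₃ + a₄ · d₄`. -/
noncomputable def wordMap (D : Finset (Fin m → Rng)) :
    ((Fin m → ZMod 2) × (Fin m → ZMod 2) × (Fin m → ZMod 2) × (Fin m → ZMod 2)) →ₗ[ZMod 2]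
      (D → ZMod 2) where
  toFun a d := a.1 ⬝ᵥ coordVec 0 d + a.2.1 ⬝ᵥ coordVec 1 d + a.2.2.1 ⬝ᵥ coordVec 2 d +
    a.2.2.2 ⬝ᵥ coordVec 3 d
  map_add' a b := by
    funext d
    simp only [Prod.fst_add, Prod.snd_add, add_dotProduct, Pi.add_apply]
    ring
  map_smul' r a := by
    funext d
    simp only [Prod.smul_fst, Prod.smul_snd, smul_dotProduct, Pi.smul_apply, smul_eq_mul,
      RingHom.id_apply]
    ring

theorem span_coord_eq_codeOfDefiningSet (D : Finset (Fin m → Rng)) :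
    Submodule.span Rng (Set.range fun (i : Fin m) (d : D) => d.1 i) = codeOfDefiningSet D := by
  apply le_antisymm
  · rw [Submodule.span_le]
    rintro _ ⟨i, rfl⟩
    exact ⟨Pi.single i 1, by funext d; simp⟩
  · rintro _ ⟨z, rfl⟩
    have : (fun d : D => z ⬝ᵥ d.1) = ∑ i, z i • fun d : D => d.1 i := by
      funext d
      simp [dotProduct, Finset.sum_apply]
    rw [this]
    exact Submodule.sum_mem _ fun i _ => Submodule.smul_mem _ _ (Submodule.subset_span ⟨i, rfl⟩)

/-- The coordinate functions `d ↦ d i` form a generator matrix, so by `subfieldCode_eq_span` the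
code is spanned by the words attached to unit vectors in one of the four slots. -/
theorem binaryCode_eq_range (D : Finset (Fin m → Rng)) :
    binaryCode D = LinearMap.range (wordMap D) := by
  rw [binaryCode, subfieldCode_eq_span bBasis bBasis _ _ (span_coord_eq_codeOfDefiningSet D)]
  have hdot : ∀ (a : Fin m → ZMod 2) (j : Fin 4), (fun d : D => a ⬝ᵥ coordVec j d.1) =
      ∑ i, a i • fun d : D => bBasis.repr (d.1 i) j := by
    intro a j
    funext d
    simp [dotProduct, coordVec, Finset.sum_apply]
  apply le_antisymm
  · rw [Submodule.span_le]
    rintro _ ⟨i, j, rfl⟩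
    fin_cases j
    · exact ⟨(Pi.single i 1, 0, 0, 0), by funext d; simp [wordMap, coordVec]⟩
    · exact ⟨(0, Pi.single i 1, 0, 0), by funext d; simp [wordMap, coordVec]⟩
    · exact ⟨(0, 0, Pi.single i 1, 0), by funext d; simp [wordMap, coordVec]⟩
    · exact ⟨(0, 0, 0, Pi.single i 1), by funext d; simp [wordMap, coordVec]⟩
  · rintro _ ⟨a, rfl⟩
    have hmem : ∀ (a : Fin m → ZMod 2) (j : Fin 4), (fun d : D => a ⬝ᵥ coordVec j d.1) ∈
        Submodule.span (ZMod 2)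
          {w : D → ZMod 2 | ∃ k, ∃ i, w = fun d => bBasis.repr (d.1 k) i} := by
      intro a j
      rw [hdot]
      exact Submodule.sum_mem _ fun i _ => Submodule.smul_mem _ _
        (Submodule.subset_span ⟨i, j, rfl⟩)
    exact Submodule.add_mem _ (Submodule.add_mem _ (Submodule.add_mem _ (hmem a.1 0)
      (hmem a.2.1 1)) (hmem a.2.2.1 2)) (hmem a.2.2.2 3)

/-- The vector over the ring with given coordinate vectors. -/
noncomputable def ofCoords
    (t : (Fin m → ZMod 2) × (Fin m → ZMod 2) × (Fin m → ZMod 2) × (Fin m → ZMod 2)) :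
    Fin m → Rng :=
  fun i => t.1 i • bvec 0 + t.2.1 i • bvec 1 + t.2.2.1 i • bvec 2 + t.2.2.2 i • bvec 3

theorem repr_bvec (i : Fin 4) : bBasis.repr (bvec i) = Finsupp.single i 1 := by
  rw [← Module.Basis.repr_self bBasis i, bBasis, Module.Basis.mk_apply]

theorem coordVec_ofCoords
    (t : (Fin m → ZMod 2) × (Fin m → ZMod 2) × (Fin m → ZMod 2) × (Fin m → ZMod 2)) :
    coordVec 0 (ofCoords t) = t.1 ∧ coordVec 1 (ofCoords t) = t.2.1 ∧
      coordVec 2 (ofCoords t) = t.2.2.1 ∧ coordVec 3 (ofCoords t) = t.2.2.2 := by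
  refine ⟨?_, ?_, ?_, ?_⟩ <;> funext i <;>
    simp [coordVec, ofCoords, repr_bvec]

theorem ofCoords_injective : Function.Injective (ofCoords (m := m)) := by
  intro s t h
  obtain ⟨s0, s1, s2, s3⟩ := coordVec_ofCoords s
  obtain ⟨t0, t1, t2, t3⟩ := coordVec_ofCoords t
  rw [h] at s0 s1 s2 s3
  exact Prod.ext (s0.symm.trans t0) (Prod.ext (s1.symm.trans t1)
    (Prod.ext (s2.symm.trans t2) (s3.symm.trans t3)))

theorem ofCoords_surjective : Function.Surjective (ofCoords (m := m)) := by
  intro d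
  refine ⟨(coordVec 0 d, coordVec 1 d, coordVec 2 d, coordVec 3 d), ?_⟩
  funext i
  conv_rhs => rw [← bBasis.sum_repr (d i)]
  simp [Fin.sum_univ_four, ofCoords, coordVec, bBasis]

theorem sum_definingSet (D₁ D₂ D₃ D₄ : Finset (Fin m → ZMod 2)) (F : (Fin m → Rng) → ℚ) :
    ∑ d ∈ definingSet D₁ D₂ D₃ D₄, F d =
      ∑ t ∈ D₁ ×ˢ D₂ ×ˢ D₃ ×ˢ D₄, F (ofCoords t) := by
  classical
  rw [← Finset.sum_image (f := F) (s := D₁ ×ˢ D₂ ×ˢ D₃ ×ˢ D₄) ofCoords_injective.injOn]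
  congr 1
  ext d
  simp only [definingSet, Finset.mem_filter, Finset.mem_univ, true_and, Finset.mem_image,
    Finset.mem_product, Prod.exists]
  constructor
  · rintro ⟨t₁, h₁, t₂, h₂, t₃, h₃, t₄, h₄, rfl⟩
    exact ⟨t₁, t₂, t₃, t₄, ⟨h₁, h₂, h₃, h₄⟩, rfl⟩
  · rintro ⟨t₁, t₂, t₃, t₄, ⟨h₁, h₂, h₃, h₄⟩, rfl⟩
    exact ⟨t₁, h₁, t₂, h₂, t₃, h₃, t₄, h₄, rfl⟩

theorem definingSet_univ :
    definingSet (Finset.univ : Finset (Fin m → ZMod 2)) Finset.univ Finset.univ Finset.univ =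
      Finset.univ := by
  ext d
  obtain ⟨t, rfl⟩ := ofCoords_surjective d
  simp only [definingSet, Finset.mem_filter, Finset.mem_univ, true_and, iff_true]
  exact ⟨t.1, t.2.1, t.2.2.1, t.2.2.2, rfl⟩

theorem card_definingSet (D₁ D₂ D₃ D₄ : Finset (Fin m → ZMod 2)) :
    ((definingSet D₁ D₂ D₃ D₄).card : ℚ) = D₁.card * (D₂.card * (D₃.card * D₄.card)) := by
  have := sum_definingSet D₁ D₂ D₃ D₄ fun _ => 1
  simpa using this

/-- The character of the word attached to `a`, at a vector over the ring. -/
noncomputable def wordSgn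
    (a : (Fin m → ZMod 2) × (Fin m → ZMod 2) × (Fin m → ZMod 2) × (Fin m → ZMod 2))
    (d : Fin m → Rng) : ℚ :=
  sgn (a.1 ⬝ᵥ coordVec 0 d + a.2.1 ⬝ᵥ coordVec 1 d + a.2.2.1 ⬝ᵥ coordVec 2 d +
    a.2.2.2 ⬝ᵥ coordVec 3 d)

theorem hammingNorm_wordMap (D : Finset (Fin m → Rng))
    (a : (Fin m → ZMod 2) × (Fin m → ZMod 2) × (Fin m → ZMod 2) × (Fin m → ZMod 2)) :
    (hammingNorm (wordMap D a) : ℚ) = (D.card - ∑ d ∈ D, wordSgn a d) / 2 := by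
  rw [hammingNorm_eq_sum_sgn, Fintype.card_coe, ← Finset.sum_coe_sort D]
  rfl

theorem sum_wordSgn (D₁ D₂ D₃ D₄ : Finset (Fin m → ZMod 2))
    (a : (Fin m → ZMod 2) × (Fin m → ZMod 2) × (Fin m → ZMod 2) × (Fin m → ZMod 2)) :
    ∑ d ∈ definingSet D₁ D₂ D₃ D₄, wordSgn a d =
      charSum D₁ a.1 * (charSum D₂ a.2.1 * (charSum D₃ a.2.2.1 * charSum D₄ a.2.2.2)) := by
  rw [sum_definingSet]
  simp only [charSum, Finset.sum_mul_sum, ← Finset.sum_product']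
  refine Finset.sum_congr rfl fun t _ => ?_
  obtain ⟨t0, t1, t2, t3⟩ := coordVec_ofCoords t
  rw [wordSgn, t0, t1, t2, t3, sgn_add, sgn_add, sgn_add]
  ring

theorem sum_wordSgn_compl (D₁ D₂ D₃ D₄ : Finset (Fin m → ZMod 2))
    (a : (Fin m → ZMod 2) × (Fin m → ZMod 2) × (Fin m → ZMod 2) × (Fin m → ZMod 2)) :
    ∑ d ∈ complSet (definingSet D₁ D₂ D₃ D₄), wordSgn a d =
      (if a = 0 then 2 ^ (4 * m) else 0) -
        charSum D₁ a.1 * (charSum D₂ a.2.1 * (charSum D₃ a.2.2.1 * charSum D₄ a.2.2.2)) := by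
  classical
  have h := Finset.sum_add_sum_compl (definingSet D₁ D₂ D₃ D₄) (wordSgn a)
  rw [← definingSet_univ, sum_wordSgn, sum_wordSgn] at h
  have hu : charSum Finset.univ a.1 * (charSum Finset.univ a.2.1 * (charSum Finset.univ a.2.2.1 *
      charSum Finset.univ a.2.2.2)) = if a = 0 then (2 : ℚ) ^ (4 * m) else 0 := by
    simp only [charSum_univ, Prod.ext_iff, Prod.fst_zero, Prod.snd_zero]
    split_ifs <;> first | tauto | ring
  rw [← hu, ← h, complSet]
  ring

theorem card_complSet (D : Finset (Fin m → Rng)) :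
    ((complSet D).card : ℚ) = 2 ^ (4 * m) - D.card := by
  classical
  have h1 := card_definingSet (m := m) Finset.univ Finset.univ Finset.univ Finset.univ
  rw [definingSet_univ] at h1
  have h2 := Finset.card_add_card_compl D
  rw [← Finset.card_univ] at h2
  have h3 : (complSet D).card = Dᶜ.card := by rw [complSet]
  have h4 : (D.card : ℚ) + (complSet D).card = (Finset.univ : Finset (Fin m → Rng)).card := by
    rw [h3]
    exact_mod_cast h2
  rw [h1] at h4
  simp only [Finset.card_univ, Fintype.card_fun, ZMod.card, Fintype.card_fin] at h4
  push_cast at h4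
  rw [← eq_sub_iff_add_eq'] at h4
  rw [h4]
  ring

end Words

/-! ### Distinctness of the weights, their positivity and their minimum. -/

section DistinctWeights

theorem two_pow_dvd_prod_sub_one {ι : Type*} (e : ι → ℕ) (n : ℕ) (U : Finset ι)
    (h : ∀ i ∈ U, n < e i) : (2 : ℤ) ^ (n + 1) ∣ ∏ i ∈ U, (1 - 2 ^ e i : ℤ) - 1 := by
  refine Finset.prod_induction _ (fun x : ℤ => 2 ^ (n + 1) ∣ x - 1) ?_ (by simp) ?_
  · intro a b ha hb
    rw [show a * b - 1 = (a - 1) * b + (b - 1) by ring]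
    exact dvd_add (ha.mul_right b) hb
  · intro i hi
    rw [sub_sub_cancel_left, dvd_neg]
    exact pow_dvd_pow _ (h i hi)

/-- For distinct positive exponents, the products of the numbers `1 - 2 ^ e i` over different sets
are different. -/
theorem prod_one_sub_two_pow_injective {ι : Type*} (e : ι → ℕ) (he : Function.Injective e)
    (h1 : ∀ i, 1 ≤ e i) :
    Function.Injective fun T : Finset ι => ∏ i ∈ T, (1 - 2 ^ e i : ℤ) := by
  classical
  intro S T hST
  by_contra hne
  have hnz : ∀ U : Finset ι, ∏ i ∈ U, (1 - 2 ^ e i : ℤ) ≠ 0 := fun U =>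
    Finset.prod_ne_zero_iff.2 fun i _ h => by
      have : (2 : ℤ) ^ 1 ≤ 2 ^ e i := pow_le_pow_right₀ (by norm_num) (h1 i)
      linarith
  -- Cancelling the common factors reduces to disjoint index sets.
  have hd : ∏ i ∈ S \ T, (1 - 2 ^ e i : ℤ) = ∏ i ∈ T \ S, (1 - 2 ^ e i : ℤ) := by
    apply mul_right_cancel₀ (hnz (S ∩ T))
    rw [← Finset.prod_union (Finset.disjoint_sdiff_inter S T), Finset.sdiff_union_inter,
      Finset.inter_comm, ← Finset.prod_union (Finset.disjoint_sdiff_inter T S),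
      Finset.sdiff_union_inter]
    exact hST
  have main : ∀ U V : Finset ι, Disjoint U V →
      ∏ i ∈ U, (1 - 2 ^ e i : ℤ) = ∏ i ∈ V, (1 - 2 ^ e i : ℤ) →
      ∀ i₀ ∈ U, (∀ i ∈ U ∪ V, e i₀ ≤ e i) → False := by
    intro U V hUV h i₀ hi₀ hmin
    rw [← Finset.mul_prod_erase U _ hi₀] at h
    obtain ⟨s, hs⟩ := two_pow_dvd_prod_sub_one e (e i₀) (U.erase i₀) (by
      intro i hi
      obtain ⟨hi0, hi⟩ := Finset.mem_erase.1 hi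
      exact lt_of_le_of_ne (hmin i (Finset.mem_union_left _ hi)) fun h => hi0 (he h.symm))
    obtain ⟨t, ht⟩ := two_pow_dvd_prod_sub_one e (e i₀) V (by
      intro i hi
      refine lt_of_le_of_ne (hmin i (Finset.mem_union_right _ hi)) fun h => ?_
      exact Finset.disjoint_left.1 hUV hi₀ (he h ▸ hi))
    -- Modulo `2 ^ (e i₀ + 1)`, with `e i₀` the least exponent, one product is `1 - 2 ^ e i₀` and
    -- the other is `1`. Dividing by `2 ^ e i₀` would make `1` even.
    have h2 : (2 : ℤ) ^ e i₀ * (2 * (s * (1 - 2 ^ e i₀) - t)) = 2 ^ e i₀ * 1 := by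
      rw [pow_succ] at hs ht
      linear_combination h + ht - (1 - 2 ^ e i₀) * hs
    have h3 := mul_left_cancel₀ (pow_ne_zero _ two_ne_zero) h2
    omega
  have hn : (S \ T ∪ T \ S).Nonempty := by
    rw [Finset.nonempty_iff_ne_empty]
    intro h
    rw [Finset.union_eq_empty, Finset.sdiff_eq_empty_iff_subset,
      Finset.sdiff_eq_empty_iff_subset] at h
    exact hne (h.1.antisymm h.2)
  obtain ⟨i₀, hi₀, hmin⟩ := Finset.exists_min_image _ e hn
  rcases Finset.mem_union.1 hi₀ with h | h
  · exact main _ _ disjoint_sdiff_sdiff hd i₀ h hmin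
  · exact main _ _ disjoint_sdiff_sdiff hd.symm i₀ h (by rwa [Finset.union_comm])

/-- The quotient `2 ^ x / (2 ^ m - 2 ^ x)`. -/
def ratio (m x : ℕ) : ℚ := 2 ^ x / (2 ^ m - 2 ^ x)

variable {m : ℕ}

theorem two_pow_lt {x : ℕ} (h : x < m) : (2 : ℚ) ^ x < 2 ^ m :=
  pow_lt_pow_right₀ (by norm_num) h

theorem ratio_pos {x : ℕ} (h : x < m) : 0 < ratio m x :=
  div_pos (by positivity) (sub_pos.2 (two_pow_lt h))

theorem neg_ratio_eq {x : ℕ} (h : x < m) :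
    -ratio m x = (((1 - 2 ^ (m - x) : ℤ)) : ℚ)⁻¹ := by
  have h1 := two_pow_lt h
  have h2 : (2 : ℚ) ^ m = 2 ^ x * 2 ^ (m - x) := by rw [← pow_add]; congr 1; omega
  have h3 : (1 : ℚ) < 2 ^ (m - x) := one_lt_pow₀ (by norm_num) (by omega)
  rw [ratio, h2]
  push_cast
  have h4 : (1 : ℚ) - 2 ^ (m - x) ≠ 0 := by linarith
  have h5 : (2 : ℚ) ^ (m - x) - 1 ≠ 0 := by linarith
  have h6 : (2 : ℚ) ^ x * 2 ^ (m - x) - 2 ^ x = 2 ^ x * (2 ^ (m - x) - 1) := by ring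
  rw [h6]
  field_simp
  ring

theorem ratio_le_ratio {x y : ℕ} (h : x ≤ y) (hy : y < m) : ratio m x ≤ ratio m y := by
  have h1 : (2 : ℚ) ^ x ≤ 2 ^ y := pow_le_pow_right₀ (by norm_num) h
  have h2 := two_pow_lt hy
  exact div_le_div₀ (by positivity) h1 (by linarith) (by linarith)

theorem ratio_le_one {x : ℕ} (h : x < m) : ratio m x ≤ 1 := by
  have h1 : (2 : ℚ) ^ (x + 1) ≤ 2 ^ m := pow_le_pow_right₀ (by norm_num) h
  have h2 := two_pow_lt h
  rw [pow_succ] at h1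
  rw [ratio, div_le_one (by linarith)]
  linarith

theorem ratio_lt_one {x : ℕ} (h : x + 1 < m) : ratio m x < 1 := by
  have h1 : (2 : ℚ) ^ (x + 1) < 2 ^ m := pow_lt_pow_right₀ (by norm_num) h
  have h2 := two_pow_lt (show x < m by omega)
  rw [pow_succ] at h1
  rw [ratio, div_lt_one (by linarith)]
  linarith

/-- The ratio reaches `1` only for the exponent `m - 1`, which two distinct exponents cannot share.
-/
theorem ratio_mul_ratio_lt_one {x y : ℕ} (hx : x < m) (hy : y < m) (hne : x ≠ y) :
    ratio m x * ratio m y < 1 := by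
  have h1 := ratio_pos hx
  have h2 := ratio_pos hy
  have h3 := ratio_le_one hx
  have h4 := ratio_le_one hy
  rcases lt_or_gt_of_ne hne with h | h
  · have := ratio_lt_one (show x + 1 < m by omega)
    nlinarith
  · have := ratio_lt_one (show y + 1 < m by omega)
    nlinarith

variable {r : ℕ} {x : Fin r → ℕ}

/-- The product of `-ratio m (x i)` over `T`. -/
def signedRatio (m : ℕ) (x : Fin r → ℕ) (T : Finset (Fin r)) : ℚ := ∏ i ∈ T, -ratio m (x i)

theorem signedRatio_injective (hx : Function.Injective x) (hm : ∀ i, x i < m) :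
    Function.Injective (signedRatio m x) := by
  intro S T h
  apply prod_one_sub_two_pow_injective (fun i => m - x i)
    (fun i j h => hx (by have := hm i; have := hm j; simp only at h; omega))
    (fun i => by have := hm i; omega)
  simp only [signedRatio, neg_ratio_eq (hm _), Finset.prod_inv_distrib, inv_inj] at h
  exact_mod_cast h

theorem signedRatio_ne_zero (hm : ∀ i, x i < m) (T : Finset (Fin r)) :
    signedRatio m x T ≠ 0 :=
  Finset.prod_ne_zero_iff.2 fun i _ => neg_ne_zero.2 (ratio_pos (hm i)).ne'

/-- For odd `T` the product is negative. A non-empty `T` of even size contains two indices, and the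
remaining ratios are at most `1`. -/
theorem signedRatio_le (hm : ∀ i, x i < m) {δ : ℚ} (h0 : 0 ≤ δ)
    (hδ : ∀ i j, i ≠ j → ratio m (x i) * ratio m (x j) ≤ δ) {T : Finset (Fin r)}
    (hT : T.Nonempty) : signedRatio m x T ≤ δ := by
  have hprod : ∀ U : Finset (Fin r), 0 ≤ ∏ i ∈ U, ratio m (x i) ∧
      ∏ i ∈ U, ratio m (x i) ≤ 1 := fun U =>
    ⟨Finset.prod_nonneg fun i _ => (ratio_pos (hm i)).le,
      Finset.prod_le_one (fun i _ => (ratio_pos (hm i)).le) fun i _ => ratio_le_one (hm i)⟩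
  rw [signedRatio, Finset.prod_neg]
  rcases Nat.even_or_odd T.card with he | ho
  · rw [he.neg_one_pow, one_mul]
    obtain ⟨i, hi, j, hj, hij⟩ := Finset.one_lt_card.1 (show 1 < T.card by
      have := hT.card_pos
      obtain ⟨k, hk⟩ := he
      omega)
    rw [← Finset.mul_prod_erase T _ hi,
      ← Finset.mul_prod_erase (T.erase i) _ (Finset.mem_erase.2 ⟨hij.symm, hj⟩), ← mul_assoc]
    exact (mul_le_of_le_one_right (mul_pos (ratio_pos (hm i)) (ratio_pos (hm j))).le
      (hprod _).2).trans (hδ i j hij)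
  · rw [ho.neg_one_pow]
    have := (hprod T).1
    linarith

/-- The weights that go with the sets in `Ts`, with their frequencies, and the weight `N / 2`. -/
def complTable (m : ℕ) (x : Fin r → ℕ) (N F : ℚ) (Ts : List (Finset (Fin r))) : List (ℚ × ℚ) :=
  Ts.map (fun T => (N / 2 * (1 - signedRatio m x T), ∏ i ∈ T, ((2 : ℚ) ^ m / 2 ^ x i - 1))) ++
    [(N / 2, F)]

theorem complTable_pos (hm : ∀ i, x i < m) (hx : Function.Injective x) {N F : ℚ} (hN : 0 < N)
    (hF : 0 < F) {Ts : List (Finset (Fin r))} (hTs : ∀ T ∈ Ts, T.Nonempty) :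
    ∀ p ∈ complTable m x N F Ts, 0 < p.1 ∧ 0 < p.2 := by
  intro p hp
  rcases List.mem_append.1 hp with hp | hp
  · obtain ⟨T, hT, rfl⟩ := List.mem_map.1 hp
    refine ⟨mul_pos (half_pos hN) (sub_pos.2 ?_), Finset.prod_pos fun i _ => ?_⟩
    -- The value `1` belongs to the empty set, so injectivity excludes it for `T`.
    · refine lt_of_le_of_ne (signedRatio_le hm zero_le_one (fun i j hij =>
        (ratio_mul_ratio_lt_one (hm i) (hm j) (hx.ne hij)).le) (hTs T hT)) fun h => ?_
      refine (hTs T hT).ne_empty (signedRatio_injective hx hm (h.trans ?_))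
      simp [signedRatio]
    · rw [sub_pos, lt_div_iff₀ (by positivity), one_mul]
      exact two_pow_lt (hm i)
  · rw [List.mem_singleton.1 hp]
    exact ⟨half_pos hN, hF⟩

theorem complTable_nodup (hm : ∀ i, x i < m) (hx : Function.Injective x) {N F : ℚ} (hN : 0 < N)
    {Ts : List (Finset (Fin r))} (hTs : Ts.Nodup) :
    ((complTable m x N F Ts).map Prod.fst).Nodup := by
  rw [complTable, List.map_append, List.map_map, List.nodup_append]
  refine ⟨hTs.map fun S T h => signedRatio_injective hx hm ?_, by simp, ?_⟩
  · have := mul_left_cancel₀ (half_pos hN).ne' h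
    linarith
  · rintro a ha b hb rfl
    obtain ⟨T, -, hT⟩ := List.mem_map.1 ha
    rw [List.map_singleton, List.mem_singleton] at hb
    simp only [Function.comp_apply, hb] at hT
    have : N / 2 * signedRatio m x T = 0 := by linarith
    exact mul_ne_zero (half_pos hN).ne' (signedRatio_ne_zero hm T) this

theorem le_of_mem_complTable (hm : ∀ i, x i < m) {N F δ : ℚ} (hN : 0 < N) (h0 : 0 ≤ δ)
    (hδ : ∀ i j, i ≠ j → ratio m (x i) * ratio m (x j) ≤ δ) {Ts : List (Finset (Fin r))}
    (hTs : ∀ T ∈ Ts, T.Nonempty) :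
    ∀ w ∈ (complTable m x N F Ts).map Prod.fst, N / 2 * (1 - δ) ≤ w := by
  intro w hw
  obtain ⟨p, hp, rfl⟩ := List.mem_map.1 hw
  rcases List.mem_append.1 hp with hp | hp
  · obtain ⟨T, hT, rfl⟩ := List.mem_map.1 hp
    have := signedRatio_le hm h0 hδ (hTs T hT)
    exact mul_le_mul_of_nonneg_left (by linarith) (half_pos hN).le
  · rw [List.mem_singleton.1 hp]
    have := half_pos hN
    exact mul_le_of_le_one_right this.le (by linarith)

variable {ι : Type*} [Fintype ι] {C : Submodule (ZMod 2) (ι → ZMod 2)}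

theorem isWeight_of_complTable (hm : ∀ i, x i < m) (hx : Function.Injective x) {N F : ℚ}
    (hN : 0 < N) (hF : 0 < F) {Ts : List (Finset (Fin r))} (hTs : ∀ T ∈ Ts, T.Nonempty)
    (hn : Ts.Nodup) (h : HasWeightEnumerator C ((0, 1) :: complTable m x N F Ts)) :
    IsWeight (Ts.length + 1) C := by
  have := h.isWeight (complTable_pos hm hx hN hF hTs) (complTable_nodup hm hx hN hn)
  simpa [complTable] using this

/-- The hypotheses on `s` and `t` say that they are the two largest exponents. Since `ratio m` is
monotone, their pair maximises `signedRatio` over the non-empty sets. -/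
theorem minDist_of_complTable (hm : ∀ i, x i < m) (hx : Function.Injective x) {N F : ℚ}
    (hN : 0 < N) (hF : 0 < F) {Ts : List (Finset (Fin r))} (hTs : ∀ T ∈ Ts, T.Nonempty)
    (h : HasWeightEnumerator C ((0, 1) :: complTable m x N F Ts))
    (hmem : ∀ i j : Fin r, i ≠ j → {i, j} ∈ Ts) {s t : ℕ} (hst : s < t) (hs : ∃ i, x i = s)
    (ht : ∃ i, x i = t) (hle : ∀ k, x k = t ∨ x k ≤ s) :
    (minDist C : ℚ) = N / 2 * (1 - ratio m s * ratio m t) := by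
  obtain ⟨i, rfl⟩ := hs
  obtain ⟨j, rfl⟩ := ht
  have hij : i ≠ j := by
    rintro rfl
    exact hst.false
  have hpos : ∀ i, 0 < ratio m (x i) := fun i => ratio_pos (hm i)
  refine h.minDist_eq (complTable_pos hm hx hN hF hTs) ?_
    (le_of_mem_complTable hm hN (mul_pos (hpos i) (hpos j)).le ?_ hTs)
  · rw [complTable, List.map_append, List.map_map]
    refine List.mem_append_left _ (List.mem_map.2 ⟨_, hmem i j hij, ?_⟩)
    simp [signedRatio, Finset.prod_pair hij]
  · have hj : ∀ k, x k ≤ x j := fun k => (hle k).elim le_of_eq fun h => h.trans hst.le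
    intro k l hkl
    rcases hle k with hk | hk
    · have hl : x l ≤ x i := (hle l).resolve_left fun h => hkl (hx (hk.trans h.symm))
      rw [hk, mul_comm]
      exact mul_le_mul_of_nonneg_right (ratio_le_ratio hl (hm i)) (hpos j).le
    · exact mul_le_mul (ratio_le_ratio hk (hm i)) (ratio_le_ratio (hj l) (hm j))
        (hpos l).le (hpos i).le

theorem minDist_of_complTable_of_subsingleton [Subsingleton (Fin r)] (hm : ∀ i, x i < m)
    {N F : ℚ} (hN : 0 < N) (hF : 0 < F) {Ts : List (Finset (Fin r))}
    (hTs : ∀ T ∈ Ts, T.Nonempty)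
    (h : HasWeightEnumerator C ((0, 1) :: complTable m x N F Ts)) :
    (minDist C : ℚ) = N / 2 := by
  refine h.minDist_eq (complTable_pos hm (Function.injective_of_subsingleton x) hN hF hTs) ?_ ?_
  · simp [complTable]
  · intro w hw
    simpa using le_of_mem_complTable (δ := 0) hm hN le_rfl
      (fun i j hij => absurd (Subsingleton.elim i j) hij) hTs w hw

end DistinctWeights

/-! ### Enumerators of product defining sets. -/

section DefiningSets

variable {m : ℕ}

/-- The product of the `κᵢ` is the size of the kernel and `K` is the number of codewords. What
remains for a given table is the identity `h`, linear in the values of `g`. -/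
theorem hasWeightEnumerator_definingSet {I₁ I₂ I₃ I₄ : Type*} [Fintype I₁] [Fintype I₂]
    [Fintype I₃] [Fintype I₄] {D₁ D₂ D₃ D₄ : Finset (Fin m → ZMod 2)} {κ₁ κ₂ κ₃ κ₄ : ℚ}
    {c₁ v₁ : I₁ → ℚ} {c₂ v₂ : I₂ → ℚ} {c₃ v₃ : I₃ → ℚ} {c₄ v₄ : I₄ → ℚ}
    (h₁ : HasDistribution (charSum D₁) κ₁ c₁ v₁) (h₂ : HasDistribution (charSum D₂) κ₂ c₂ v₂)
    (h₃ : HasDistribution (charSum D₃) κ₃ c₃ v₃) (h₄ : HasDistribution (charSum D₄) κ₄ c₄ v₄)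
    {N K : ℚ} {T : List (ℚ × ℚ)} (T' : List (ℚ × ℚ))
    (hN : (D₁.card : ℚ) * D₂.card * D₃.card * D₄.card = N)
    (hK : ((2 : ℚ) ^ m) ^ 4 = κ₁ * κ₂ * κ₃ * κ₄ * K) (hTT' : T = (0, 1) :: T')
    (hT : ∀ r ∈ T', 0 < r.1)
    (h : ∀ g : ℚ → ℚ, ∑ i₁, ∑ i₂, ∑ i₃, ∑ i₄, c₁ i₁ * c₂ i₂ * c₃ i₃ * c₄ i₄ *
      (g ((N - v₁ i₁ * v₂ i₂ * v₃ i₃ * v₄ i₄) / 2) - g (N / 2)) + K * g (N / 2) =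
      (T.map fun r : ℚ × ℚ => r.2 * g r.1).sum) :
    HasWeightEnumerator (binaryCode (definingSet D₁ D₂ D₃ D₄)) T ∧ (T.map Prod.snd).sum = K := by
  refine ⟨?_, by simpa using (h fun _ => 1).symm⟩
  subst hTT'
  have hκ : κ₁ * κ₂ * κ₃ * κ₄ ≠ 0 := by
    intro h0
    rw [h0, zero_mul] at hK
    exact absurd hK (by positivity)
  rw [binaryCode_eq_range]
  refine (h₁.prod (h₂.prod (h₃.prod h₄))).hasWeightEnumerator (N := N) (K := K) (fun a => ?_) ?_ ?_
    hT fun g => ?_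
  · rw [hammingNorm_wordMap, sum_wordSgn, card_definingSet, ← hN]
    ring
  · simpa only [mul_assoc] using hκ
  · simp only [Fintype.card_prod, Fintype.card_fun, ZMod.card, Fintype.card_fin]
    push_cast
    linear_combination hK
  · rw [← h g]
    simp only [Fintype.sum_prod_type, mul_assoc]

end DefiningSets

/-! ### Optimality criteria in terms of powers of two. -/

section Optimality

variable {ι : Type*} [Fintype ι] {C : Submodule (ZMod 2) (ι → ZMod 2)}

theorem attainsGriesmer_of_two_pow_sub {K t : ℕ} (ht : 1 ≤ t) (htK : t < K)
    (hdim : dimension C = K) (hlen : (length C : ℚ) = 2 ^ K - 2 ^ t)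
    (hmin : (minDist C : ℚ) = (2 ^ K - 2 ^ t) / 2) : AttainsGriesmer C := by
  obtain ⟨a, rfl⟩ := Nat.exists_eq_add_of_le' ht
  obtain ⟨L, rfl⟩ := Nat.exists_eq_add_of_le' (show 1 ≤ K by omega)
  have := sum_ceil_two_pow_sub (L + 1) a (minDist C) htK (by
    rw [hmin, Nat.add_sub_cancel, pow_succ, pow_succ]
    ring)
  rw [← hlen] at this
  rw [AttainsGriesmer, hdim]
  exact_mod_cast this.symm

theorem isDistanceOptimal_of_two_pow {K : ℕ} (hK : 2 ≤ K) (hdim : dimension C = K)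
    (hlen : (length C : ℚ) = 2 ^ K) (hmin : (minDist C : ℚ) = 2 ^ K / 2) :
    IsDistanceOptimal C := by
  have hl : length C = 2 ^ K := by exact_mod_cast hlen
  have hd : minDist C = 2 ^ (K - 1) := by
    obtain ⟨L, rfl⟩ := Nat.exists_eq_add_of_le' (show 1 ≤ K by omega)
    rw [pow_succ, mul_div_cancel_right₀ _ two_ne_zero] at hmin
    exact_mod_cast hmin
  apply isDistanceOptimal_of_lt
  rw [hl, hdim, hd]
  exact lt_sum_ceil_two_pow_add_one K hK

/-- The Griesmer sum for `d + 1` is at least `2 ^ K - 2 ^ a - 2 ^ b + a + 1`, which exceeds the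
length when `2 ^ t ≤ a`. -/
theorem isDistanceOptimal_of_two_pow_sub_sub {K a b t : ℕ} (hab : a < b) (hb : b < K)
    (h : 2 ^ t ≤ a) (hdim : dimension C = K)
    (hlen : (length C : ℚ) = 2 ^ K - 2 ^ a - 2 ^ b + 2 ^ t)
    (hmin : (minDist C : ℚ) = (2 ^ K - 2 ^ a - 2 ^ b) / 2) : IsDistanceOptimal C := by
  have ha : 1 ≤ a := Nat.one_le_two_pow.trans h
  obtain ⟨a, rfl⟩ := Nat.exists_eq_add_of_le' ha
  obtain ⟨b, rfl⟩ := Nat.exists_eq_add_of_le' (show 1 ≤ b by omega)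
  obtain ⟨L, rfl⟩ := Nat.exists_eq_add_of_le' (show 1 ≤ K by omega)
  have key := le_sum_ceil_two_pow_sub_sub (L + 1) a b (minDist C + 1) (by omega) (by omega) (by
    push_cast
    rw [hmin]
    ring)
  apply isDistanceOptimal_of_lt
  rw [hdim]
  have h' : (2 : ℚ) ^ t ≤ a + 1 := by exact_mod_cast h
  have : (length C : ℚ) < ((∑ i ∈ Finset.range (L + 1),
      ⌈((minDist C + 1 : ℕ) : ℚ) / 2 ^ i⌉₊ : ℕ) : ℚ) := by
    linarith
  exact_mod_cast this

end Optimality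

/-! ### The explicit tables as instances of `complTable`. -/

section Tables

/-- With no complemented slot only the weight `N / 2` remains; the parameter `0` in place of `m` is
a dummy. -/
theorem table0_eq (x y z w : ℕ) : table0 x y z w = (0, 1) ::
    complTable 0 ![] (2 ^ x * 2 ^ y * 2 ^ z * 2 ^ w) (2 ^ x * 2 ^ y * 2 ^ z * 2 ^ w - 1) [] := by
  simp only [table0, complTable, List.map_nil, List.nil_append]
  simp only [zpow_sub₀ (two_ne_zero' ℚ), zpow_add₀ (two_ne_zero' ℚ), zpow_natCast, pow_add,
    zpow_one]

theorem table1_eq {m x : ℕ} (y z w : ℕ) (hx : x < m) : table1 m x y z w = (0, 1) ::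
    complTable m ![x] ((2 ^ m - 2 ^ x) * 2 ^ y * 2 ^ z * 2 ^ w)
      (2 ^ m * 2 ^ y * 2 ^ z * 2 ^ w - 2 ^ m / 2 ^ x) [{0}] := by
  have h1 := (sub_pos.2 (two_pow_lt hx)).ne'
  simp only [table1, complTable, signedRatio, ratio, List.map_cons, List.map_nil,
    List.cons_append, List.nil_append, Finset.prod_singleton, Matrix.cons_val_zero,
    List.cons.injEq, Prod.mk.injEq, true_and, and_true]
  simp only [zpow_sub₀ (two_ne_zero' ℚ), zpow_add₀ (two_ne_zero' ℚ), zpow_natCast, pow_add,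
    zpow_one]
  refine ⟨⟨?_, trivial⟩, ?_, trivial⟩ <;> field_simp
  ring

/-- The order of the sets is the order of the rows in the table. -/
theorem table2_eq {m x y : ℕ} (z w : ℕ) (hx : x < m) (hy : y < m) :
    table2 m x y z w = (0, 1) ::
      complTable m ![x, y] ((2 ^ m - 2 ^ x) * (2 ^ m - 2 ^ y) * 2 ^ z * 2 ^ w)
        ((2 ^ m) ^ 2 * 2 ^ z * 2 ^ w - 2 ^ m / 2 ^ x * (2 ^ m / 2 ^ y)) [{1}, {0}, {0, 1}] := by
  have h1 := (sub_pos.2 (two_pow_lt hx)).ne'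
  have h2 := (sub_pos.2 (two_pow_lt hy)).ne'
  simp (disch := decide) only [table2, complTable, signedRatio, ratio, List.map_cons,
    List.map_nil, List.cons_append, List.nil_append, Finset.prod_singleton, Finset.prod_insert,
    Matrix.cons_val, List.cons.injEq, Prod.mk.injEq, true_and, and_true]
  simp only [zpow_sub₀ (two_ne_zero' ℚ), zpow_add₀ (two_ne_zero' ℚ), zpow_natCast, pow_add,
    pow_mul', zpow_mul', zpow_ofNat]
  have ha : (2 : ℚ) ^ x ≠ 0 := by positivity
  have hb : (2 : ℚ) ^ y ≠ 0 := by positivity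
  -- With the powers of two as independent variables, each entry becomes an identity of rational
  -- functions.
  generalize (2 : ℚ) ^ m = M at *
  generalize (2 : ℚ) ^ x = a at *
  generalize (2 : ℚ) ^ y = b at *
  and_intros
  all_goals first | trivial | ring1 | (field_simp; done) | (field_simp; ring1)

theorem table3_eq {m x y z : ℕ} (w : ℕ) (hx : x < m) (hy : y < m) (hz : z < m) :
    table3 m x y z w = (0, 1) ::
      complTable m ![x, y, z] ((2 ^ m - 2 ^ x) * (2 ^ m - 2 ^ y) * (2 ^ m - 2 ^ z) * 2 ^ w)
        ((2 ^ m) ^ 3 * 2 ^ w - 2 ^ m / 2 ^ x * (2 ^ m / 2 ^ y) * (2 ^ m / 2 ^ z))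
        [{2}, {1}, {0}, {1, 2}, {0, 2}, {0, 1}, {0, 1, 2}] := by
  have h1 := (sub_pos.2 (two_pow_lt hx)).ne'
  have h2 := (sub_pos.2 (two_pow_lt hy)).ne'
  have h3 := (sub_pos.2 (two_pow_lt hz)).ne'
  simp (disch := decide) only [table3, complTable, signedRatio, ratio, List.map_cons,
    List.map_nil, List.cons_append, List.nil_append, Finset.prod_singleton, Finset.prod_insert,
    Matrix.cons_val, List.cons.injEq, Prod.mk.injEq, true_and, and_true]
  simp only [zpow_sub₀ (two_ne_zero' ℚ), zpow_add₀ (two_ne_zero' ℚ), zpow_natCast, pow_add,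
    pow_mul', zpow_mul', zpow_ofNat]
  have ha : (2 : ℚ) ^ x ≠ 0 := by positivity
  have hb : (2 : ℚ) ^ y ≠ 0 := by positivity
  have hc : (2 : ℚ) ^ z ≠ 0 := by positivity
  generalize (2 : ℚ) ^ m = M at *
  generalize (2 : ℚ) ^ x = a at *
  generalize (2 : ℚ) ^ y = b at *
  generalize (2 : ℚ) ^ z = c at *
  and_intros
  all_goals first | trivial | ring1 | (field_simp; done) | (field_simp; ring1)

theorem table4_eq {m x y z w : ℕ} (hx : x < m) (hy : y < m) (hz : z < m) (hw : w < m) :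
    table4 m x y z w = (0, 1) ::
      complTable m ![x, y, z, w]
        ((2 ^ m - 2 ^ x) * (2 ^ m - 2 ^ y) * (2 ^ m - 2 ^ z) * (2 ^ m - 2 ^ w))
        ((2 ^ m) ^ 4 -
          2 ^ m / 2 ^ x * (2 ^ m / 2 ^ y) * (2 ^ m / 2 ^ z) * (2 ^ m / 2 ^ w))
        [{1}, {2}, {3}, {0}, {1, 2}, {1, 3}, {2, 3}, {0, 1}, {0, 2}, {0, 3},
          {1, 2, 3}, {0, 1, 2}, {0, 1, 3}, {0, 2, 3}, {0, 1, 2, 3}] := by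
  have h1 := (sub_pos.2 (two_pow_lt hx)).ne'
  have h2 := (sub_pos.2 (two_pow_lt hy)).ne'
  have h3 := (sub_pos.2 (two_pow_lt hz)).ne'
  have h4 := (sub_pos.2 (two_pow_lt hw)).ne'
  simp (disch := decide) only [table4, complTable, signedRatio, ratio, List.map_cons,
    List.map_nil, List.cons_append, List.nil_append, Finset.prod_singleton, Finset.prod_insert,
    Matrix.cons_val, List.cons.injEq, Prod.mk.injEq, true_and, and_true]
  simp only [zpow_sub₀ (two_ne_zero' ℚ), zpow_natCast, pow_add, zpow_neg,
    pow_mul', zpow_mul', zpow_ofNat]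
  have ha : (2 : ℚ) ^ x ≠ 0 := by positivity
  have hb : (2 : ℚ) ^ y ≠ 0 := by positivity
  have hc : (2 : ℚ) ^ z ≠ 0 := by positivity
  have hd : (2 : ℚ) ^ w ≠ 0 := by positivity
  generalize (2 : ℚ) ^ m = M at *
  generalize (2 : ℚ) ^ x = a at *
  generalize (2 : ℚ) ^ y = b at *
  generalize (2 : ℚ) ^ z = c at *
  generalize (2 : ℚ) ^ w = d at *
  and_intros
  all_goals first | trivial | ring1 | (field_simp; done) | (field_simp; ring1)

theorem tableCompl_eq {m x y z w : ℕ} (h : x + y + z + w < 4 * m) :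
    tableCompl m x y z w = (0, 1) ::
      complTable (4 * m) ![x + y + z + w] (2 ^ (4 * m) - 2 ^ (x + y + z + w))
        (2 ^ (4 * m) - 2 ^ (4 * m) / 2 ^ (x + y + z + w)) [{0}] := by
  have h1 := (sub_pos.2 (two_pow_lt h)).ne'
  simp only [tableCompl, complTable, signedRatio, ratio, List.map_cons, List.map_nil,
    List.cons_append, List.nil_append, Finset.prod_singleton, Matrix.cons_val_zero,
    List.cons.injEq, Prod.mk.injEq, true_and, and_true]
  have e1 : (2 : ℚ) ^ (4 * m - 1 : ℤ) = 2 ^ (4 * m) / 2 := by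
    rw [zpow_sub₀ two_ne_zero, zpow_one]
    norm_cast
  have e2 : (2 : ℚ) ^ (x + y + z + w - 1 : ℤ) = 2 ^ (x + y + z + w) / 2 := by
    rw [zpow_sub₀ two_ne_zero, zpow_one]
    norm_cast
  have e3 : (2 : ℚ) ^ (4 * m - x - y - z - w : ℤ) = 2 ^ (4 * m) / 2 ^ (x + y + z + w) := by
    rw [show (4 * m - x - y - z - w : ℤ) = ((4 * m : ℕ) : ℤ) - ((x + y + z + w : ℕ) : ℤ) by
      push_cast; ring, zpow_sub₀ two_ne_zero, zpow_natCast, zpow_natCast]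
  rw [e1, e2, e3]
  generalize (2 : ℚ) ^ (4 * m) = M at *
  generalize (2 : ℚ) ^ (x + y + z + w) = a at *
  and_intros
  all_goals first | trivial | ring1 | (field_simp; done) | (field_simp; ring1)

end Tables

/-! ### Verification of the enumerator of each family. -/

section Enumerators

variable {m : ℕ}

theorem card_simplicial_cast (X : Finset (Fin m)) : ((simplicial X).card : ℚ) = 2 ^ X.card := by
  exact_mod_cast card_simplicial X

theorem card_simplicial_compl_cast (X : Finset (Fin m)) :
    (((simplicial X)ᶜ).card : ℚ) = 2 ^ m - 2 ^ X.card := by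
  rw [← charSum_zero, charSum_compl, if_pos rfl, charSum_zero, card_simplicial_cast]

theorem length_binaryCode (D : Finset (Fin m → Rng)) : length (binaryCode D) = D.card :=
  Fintype.card_coe D

/-- This makes the frequency of the weight `N / 2` positive. -/
theorem one_lt_two_pow_mul {x y z w : ℕ} (h : 1 ≤ x + y + z + w) :
    (1 : ℚ) < 2 ^ x * 2 ^ y * 2 ^ z * 2 ^ w := by
  simp only [← pow_add]
  exact one_lt_pow₀ (by norm_num) (by omega)

theorem hasWeightEnumerator_table0 (X Y Z W : Finset (Fin m))
    (h : 1 ≤ X.card + Y.card + Z.card + W.card) :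
    HasWeightEnumerator
      (binaryCode (definingSet (simplicial X) (simplicial Y) (simplicial Z) (simplicial W)))
      (table0 X.card Y.card Z.card W.card) ∧
    ((table0 X.card Y.card Z.card W.card).map Prod.snd).sum =
      2 ^ X.card * 2 ^ Y.card * 2 ^ Z.card * 2 ^ W.card := by
  have hF := sub_pos.2 (one_lt_two_pow_mul h)
  refine hasWeightEnumerator_definingSet
    (N := 2 ^ X.card * 2 ^ Y.card * 2 ^ Z.card * 2 ^ W.card)
    (hasDistribution_charSum_simplicial X)
    (hasDistribution_charSum_simplicial Y) (hasDistribution_charSum_simplicial Z)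
    (hasDistribution_charSum_simplicial W) _ (by simp only [card_simplicial_cast]) ?_
    (table0_eq _ _ _ _) (fun r hr => (complTable_pos finZeroElim
      (Function.injective_of_subsingleton _) (by positivity) hF (by simp) r hr).1) fun g => ?_
  · field_simp
  · simp only [table0_eq, complTable, Finset.univ_unique, Finset.sum_singleton, List.map_cons,
      List.map_nil, List.nil_append, List.sum_cons, List.sum_nil]
    ring_nf

theorem hasWeightEnumerator_table1 (X Y Z W : Finset (Fin m)) (hX : X.card < m)
    (h : 1 ≤ X.card + Y.card + Z.card + W.card) :
    (0 : ℚ) < 2 ^ m * 2 ^ Y.card * 2 ^ Z.card * 2 ^ W.card - 2 ^ m / 2 ^ X.card ∧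
    HasWeightEnumerator
      (binaryCode (definingSet (simplicial X)ᶜ (simplicial Y) (simplicial Z) (simplicial W)))
      (table1 m X.card Y.card Z.card W.card) ∧
    ((table1 m X.card Y.card Z.card W.card).map Prod.snd).sum =
      2 ^ m * 2 ^ Y.card * 2 ^ Z.card * 2 ^ W.card := by
  have h1 := sub_pos.2 (two_pow_lt hX)
  have hF : (0 : ℚ) < 2 ^ m * 2 ^ Y.card * 2 ^ Z.card * 2 ^ W.card - 2 ^ m / 2 ^ X.card := by
    have := mul_lt_mul_of_pos_left (one_lt_two_pow_mul h) (show (0 : ℚ) < 2 ^ m by positivity)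
    rw [sub_pos, div_lt_iff₀ (by positivity)]
    linarith
  refine ⟨hF, hasWeightEnumerator_definingSet
    (N := (2 ^ m - 2 ^ X.card) * 2 ^ Y.card * 2 ^ Z.card * 2 ^ W.card)
    (hasDistribution_charSum_compl X)
    (hasDistribution_charSum_simplicial Y) (hasDistribution_charSum_simplicial Z)
    (hasDistribution_charSum_simplicial W) _
    (by simp only [card_simplicial_cast, card_simplicial_compl_cast]) ?_ (table1_eq _ _ _ hX)
    (fun r hr => (complTable_pos (by simpa using hX) (Function.injective_of_subsingleton _)
      (by positivity) hF (by simp) r hr).1) fun g => ?_⟩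
  · field_simp
  · simp only [table1, Fintype.sum_bool, Finset.univ_unique, Finset.sum_singleton, List.map_cons,
      List.map_nil, List.sum_cons, List.sum_nil, if_true, Bool.false_eq_true, if_false]
    simp only [zpow_sub₀ (two_ne_zero' ℚ), zpow_add₀ (two_ne_zero' ℚ), zpow_natCast, pow_add]
    ring_nf

theorem injective_pair {x y : ℕ} (hxy : x ≠ y) : Function.Injective ![x, y] := by
  intro i j h
  fin_cases i <;> fin_cases j <;> simp_all

theorem hasWeightEnumerator_table2 (X Y Z W : Finset (Fin m)) (hXY : X.card ≠ Y.card)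
    (hX : X.card < m) (hY : Y.card < m) :
    (0 : ℚ) < (2 ^ m) ^ 2 * 2 ^ Z.card * 2 ^ W.card - 2 ^ m / 2 ^ X.card * (2 ^ m / 2 ^ Y.card) ∧
    HasWeightEnumerator
      (binaryCode (definingSet (simplicial X)ᶜ (simplicial Y)ᶜ (simplicial Z) (simplicial W)))
      (table2 m X.card Y.card Z.card W.card) ∧
    ((table2 m X.card Y.card Z.card W.card).map Prod.snd).sum =
      (2 ^ m) ^ 2 * 2 ^ Z.card * 2 ^ W.card := by
  have h1 := sub_pos.2 (two_pow_lt hX)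
  have h2 := sub_pos.2 (two_pow_lt hY)
  have hF : (0 : ℚ) < (2 ^ m) ^ 2 * 2 ^ Z.card * 2 ^ W.card -
      2 ^ m / 2 ^ X.card * (2 ^ m / 2 ^ Y.card) := by
    -- Distinct cardinalities are not both zero, so no separate non-emptiness hypothesis is needed.
    have := mul_lt_mul_of_pos_left (one_lt_two_pow_mul
      (show 1 ≤ X.card + Y.card + Z.card + W.card by omega))
      (show (0 : ℚ) < (2 ^ m) ^ 2 by positivity)
    rw [sub_pos, div_mul_div_comm, div_lt_iff₀ (by positivity)]
    linarith
  refine ⟨hF, hasWeightEnumerator_definingSet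
    (N := (2 ^ m - 2 ^ X.card) * (2 ^ m - 2 ^ Y.card) * 2 ^ Z.card * 2 ^ W.card)
    (hasDistribution_charSum_compl X)
    (hasDistribution_charSum_compl Y) (hasDistribution_charSum_simplicial Z)
    (hasDistribution_charSum_simplicial W) _
    (by simp only [card_simplicial_cast, card_simplicial_compl_cast]) ?_ (table2_eq _ _ hX hY)
    (fun r hr => (complTable_pos (by simp [Fin.forall_fin_succ, hX, hY]) (injective_pair hXY)
      (by positivity) hF (by simp) r hr).1) fun g => ?_⟩
  · field_simp
  · simp only [table2, Fintype.sum_bool, Finset.univ_unique, Finset.sum_singleton, List.map_cons,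
      List.map_nil, List.sum_cons, List.sum_nil, if_true, Bool.false_eq_true, if_false]
    simp only [zpow_sub₀ (two_ne_zero' ℚ), zpow_add₀ (two_ne_zero' ℚ), zpow_natCast, pow_add,
      pow_mul', zpow_mul', zpow_ofNat]
    ring_nf

theorem injective_triple {x y z : ℕ} (hxy : x ≠ y) (hxz : x ≠ z) (hyz : y ≠ z) :
    Function.Injective ![x, y, z] := by
  intro i j h
  fin_cases i <;> fin_cases j <;> simp_all

theorem hasWeightEnumerator_table3 (X Y Z W : Finset (Fin m)) (hXY : X.card ≠ Y.card)
    (hXZ : X.card ≠ Z.card) (hYZ : Y.card ≠ Z.card)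
    (hX : X.card < m) (hY : Y.card < m) (hZ : Z.card < m) :
    (0 : ℚ) < (2 ^ m) ^ 3 * 2 ^ W.card -
      2 ^ m / 2 ^ X.card * (2 ^ m / 2 ^ Y.card) * (2 ^ m / 2 ^ Z.card) ∧
    HasWeightEnumerator
      (binaryCode (definingSet (simplicial X)ᶜ (simplicial Y)ᶜ (simplicial Z)ᶜ (simplicial W)))
      (table3 m X.card Y.card Z.card W.card) ∧
    ((table3 m X.card Y.card Z.card W.card).map Prod.snd).sum = (2 ^ m) ^ 3 * 2 ^ W.card := by
  have h1 := sub_pos.2 (two_pow_lt hX)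
  have h2 := sub_pos.2 (two_pow_lt hY)
  have h3 := sub_pos.2 (two_pow_lt hZ)
  have hF : (0 : ℚ) < (2 ^ m) ^ 3 * 2 ^ W.card -
      2 ^ m / 2 ^ X.card * (2 ^ m / 2 ^ Y.card) * (2 ^ m / 2 ^ Z.card) := by
    have := mul_lt_mul_of_pos_left (one_lt_two_pow_mul
      (show 1 ≤ X.card + Y.card + Z.card + W.card by omega))
      (show (0 : ℚ) < (2 ^ m) ^ 3 by positivity)
    rw [sub_pos, div_mul_div_comm, div_mul_div_comm, div_lt_iff₀ (by positivity)]
    linarith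
  refine ⟨hF, hasWeightEnumerator_definingSet
    (N := (2 ^ m - 2 ^ X.card) * (2 ^ m - 2 ^ Y.card) * (2 ^ m - 2 ^ Z.card) * 2 ^ W.card)
    (hasDistribution_charSum_compl X)
    (hasDistribution_charSum_compl Y) (hasDistribution_charSum_compl Z)
    (hasDistribution_charSum_simplicial W) _
    (by simp only [card_simplicial_cast, card_simplicial_compl_cast]) ?_ (table3_eq _ hX hY hZ)
    (fun r hr => (complTable_pos (by simp [Fin.forall_fin_succ, hX, hY, hZ])
      (injective_triple hXY hXZ hYZ) (by positivity) hF (by simp) r hr).1) fun g => ?_⟩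
  · field_simp
  · simp only [table3, Fintype.sum_bool, Finset.univ_unique, Finset.sum_singleton, List.map_cons,
      List.map_nil, List.sum_cons, List.sum_nil, if_true, Bool.false_eq_true, if_false]
    simp only [zpow_sub₀ (two_ne_zero' ℚ), zpow_add₀ (two_ne_zero' ℚ), zpow_natCast, pow_add,
      pow_mul', zpow_mul', zpow_ofNat]
    ring_nf

theorem injective_quadruple {x y z w : ℕ} (hxy : x ≠ y) (hxz : x ≠ z) (hxw : x ≠ w)
    (hyz : y ≠ z) (hyw : y ≠ w) (hzw : z ≠ w) : Function.Injective ![x, y, z, w] := by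
  intro i j h
  fin_cases i <;> fin_cases j <;> simp_all

theorem hasWeightEnumerator_table4 (X Y Z W : Finset (Fin m)) (hXY : X.card ≠ Y.card)
    (hXZ : X.card ≠ Z.card) (hXW : X.card ≠ W.card) (hYZ : Y.card ≠ Z.card)
    (hYW : Y.card ≠ W.card) (hZW : Z.card ≠ W.card)
    (hX : X.card < m) (hY : Y.card < m) (hZ : Z.card < m) (hW : W.card < m) :
    (0 : ℚ) < (2 ^ m) ^ 4 -
      2 ^ m / 2 ^ X.card * (2 ^ m / 2 ^ Y.card) * (2 ^ m / 2 ^ Z.card) * (2 ^ m / 2 ^ W.card) ∧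
    HasWeightEnumerator
      (binaryCode (definingSet (simplicial X)ᶜ (simplicial Y)ᶜ (simplicial Z)ᶜ (simplicial W)ᶜ))
      (table4 m X.card Y.card Z.card W.card) ∧
    ((table4 m X.card Y.card Z.card W.card).map Prod.snd).sum = (2 ^ m) ^ 4 := by
  have h1 := sub_pos.2 (two_pow_lt hX)
  have h2 := sub_pos.2 (two_pow_lt hY)
  have h3 := sub_pos.2 (two_pow_lt hZ)
  have h4 := sub_pos.2 (two_pow_lt hW)
  have hF : (0 : ℚ) < (2 ^ m) ^ 4 -
      2 ^ m / 2 ^ X.card * (2 ^ m / 2 ^ Y.card) * (2 ^ m / 2 ^ Z.card) * (2 ^ m / 2 ^ W.card) := by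
    have := mul_lt_mul_of_pos_left (one_lt_two_pow_mul
      (show 1 ≤ X.card + Y.card + Z.card + W.card by omega))
      (show (0 : ℚ) < (2 ^ m) ^ 4 by positivity)
    rw [sub_pos, div_mul_div_comm, div_mul_div_comm, div_mul_div_comm,
      div_lt_iff₀ (by positivity)]
    linarith
  refine ⟨hF, hasWeightEnumerator_definingSet
    (N := (2 ^ m - 2 ^ X.card) * (2 ^ m - 2 ^ Y.card) * (2 ^ m - 2 ^ Z.card) *
      (2 ^ m - 2 ^ W.card))
    (hasDistribution_charSum_compl X)
    (hasDistribution_charSum_compl Y) (hasDistribution_charSum_compl Z)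
    (hasDistribution_charSum_compl W) _
    (by simp only [card_simplicial_compl_cast]) ?_ (table4_eq hX hY hZ hW)
    (fun r hr => (complTable_pos (by simp [Fin.forall_fin_succ, hX, hY, hZ, hW])
      (injective_quadruple hXY hXZ hXW hYZ hYW hZW) (by positivity) hF (by simp) r hr).1)
      fun g => ?_⟩
  · ring
  · simp only [table4, Fintype.sum_bool, List.map_cons,
      List.map_nil, List.sum_cons, List.sum_nil, if_true, Bool.false_eq_true, if_false]
    simp only [zpow_sub₀ (two_ne_zero' ℚ), zpow_natCast, pow_add, zpow_neg,
      pow_mul', zpow_mul', zpow_ofNat]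
    ring_nf

theorem hasWeightEnumerator_tableCompl (X Y Z W : Finset (Fin m))
    (h : 1 ≤ X.card + Y.card + Z.card + W.card)
    (hlt : X.card + Y.card + Z.card + W.card < 4 * m) :
    (0 : ℚ) < 2 ^ (4 * m) - 2 ^ (4 * m) / 2 ^ (X.card + Y.card + Z.card + W.card) ∧
    HasWeightEnumerator
      (binaryCode (complSet
        (definingSet (simplicial X) (simplicial Y) (simplicial Z) (simplicial W))))
      (tableCompl m X.card Y.card Z.card W.card) ∧
    ((tableCompl m X.card Y.card Z.card W.card).map Prod.snd).sum = 2 ^ (4 * m) := by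
  set s := X.card + Y.card + Z.card + W.card with hs
  have hN := sub_pos.2 (two_pow_lt hlt)
  have hF : (0 : ℚ) < 2 ^ (4 * m) - 2 ^ (4 * m) / 2 ^ s := by
    rw [sub_pos, div_lt_iff₀ (by positivity)]
    exact lt_mul_of_one_lt_right (by positivity) (one_lt_pow₀ (by norm_num) (by omega))
  -- The product of four sums with one non-zero value each again has a single non-zero value, so the
  -- complement of the whole set is handled by one use of `HasDistribution.compl`, with multiplier
  -- `1`.
  have hprod : HasDistribution
      (fun a : (Fin m → ZMod 2) × (Fin m → ZMod 2) × (Fin m → ZMod 2) × (Fin m → ZMod 2) =>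
        charSum (simplicial X) a.1 * (charSum (simplicial Y) a.2.1 *
          (charSum (simplicial Z) a.2.2.1 * charSum (simplicial W) a.2.2.2)))
      (2 ^ (4 * m) / 2 ^ s) (fun _ : Unit => 1) (fun _ => 2 ^ s) := by
    intro f f0
    rw [(hasDistribution_charSum_simplicial X).prod
      ((hasDistribution_charSum_simplicial Y).prod ((hasDistribution_charSum_simplicial Z).prod
        (hasDistribution_charSum_simplicial W))) f f0, hs]
    simp only [Fintype.sum_prod_type, Finset.univ_unique, Finset.sum_singleton, one_mul, pow_add,
      pow_mul', ← mul_assoc]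
    congr 1
    field_simp
  have hdist := hprod.compl (by
    simp only [Prod.fst_zero, Prod.snd_zero, charSum_zero, card_simplicial_cast, hs]
    ring) (2 ^ (4 * m))
  rw [tableCompl_eq hlt, binaryCode_eq_range, ← hs]
  refine ⟨hF, hdist.hasWeightEnumerator (N := 2 ^ (4 * m) - 2 ^ s) (K := 2 ^ (4 * m))
    (fun a => ?_) one_ne_zero ?_ (fun r hr => (complTable_pos (by simpa using hlt)
      (Function.injective_of_subsingleton _) hN hF (by simp) r hr).1) fun g => ?_, ?_⟩
  · rw [hammingNorm_wordMap, sum_wordSgn_compl, card_complSet, card_definingSet]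
    simp only [card_simplicial_cast, hs]
    congr 2
    ring
  · simp only [Fintype.card_prod, Fintype.card_fun, ZMod.card, Fintype.card_fin]
    push_cast
    ring
  · rw [← tableCompl_eq hlt]
    have e1 : (2 : ℚ) ^ (4 * m - 1 : ℤ) = 2 ^ (4 * m) / 2 := by
      rw [zpow_sub₀ two_ne_zero, zpow_one]
      norm_cast
    have e2 : (2 : ℚ) ^ (X.card + Y.card + Z.card + W.card - 1 : ℤ) = 2 ^ s / 2 := by
      rw [zpow_sub₀ two_ne_zero, zpow_one, hs]
      norm_cast
    have e3 : (2 : ℚ) ^ (4 * m - X.card - Y.card - Z.card - W.card : ℤ) =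
        2 ^ (4 * m) / 2 ^ s := by
      rw [show (4 * m - X.card - Y.card - Z.card - W.card : ℤ) =
        ((4 * m : ℕ) : ℤ) - ((s : ℕ) : ℤ) by
        push_cast [hs]; ring, zpow_sub₀ two_ne_zero, zpow_natCast, zpow_natCast]
    simp only [tableCompl, e1, e2, e3, Fintype.sum_bool, List.map_cons,
      List.map_nil, List.sum_cons, List.sum_nil, if_true, Bool.false_eq_true, if_false]
    ring_nf
  · simp [complTable]

end Enumerators

/-! ### Length, dimension, minimum distance and optimality of each family. -/

section Parameters

variable {m : ℕ}

theorem parameters_no_compl (X Y Z W : Finset (Fin m))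
    (h : 1 ≤ X.card + Y.card + Z.card + W.card) {C}
    (hC : C = binaryCode
      (definingSet (simplicial X) (simplicial Y) (simplicial Z) (simplicial W))) :
    IsWeight 1 C ∧ (length C : ℚ) = 2 ^ (X.card + Y.card + Z.card + W.card) ∧
    dimension C = X.card + Y.card + Z.card + W.card ∧
    (minDist C : ℚ) = 2 ^ (X.card + Y.card + Z.card + W.card - 1 : ℤ) ∧
    HasWeightTable C (table0 X.card Y.card Z.card W.card) ∧
    (2 ≤ X.card + Y.card + Z.card + W.card → IsDistanceOptimal C) := by
  obtain ⟨hE, hsum⟩ := hasWeightEnumerator_table0 X Y Z W h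
  rw [← hC] at hE
  have hdim : dimension C = X.card + Y.card + Z.card + W.card := hE.dimension_eq (by
    rw [hsum]; ring)
  have hlen : (length C : ℚ) = 2 ^ (X.card + Y.card + Z.card + W.card) := by
    subst hC
    rw [length_binaryCode, card_definingSet]
    simp only [card_simplicial_cast]
    ring
  have hE' := hE
  rw [table0_eq] at hE'
  have hF := sub_pos.2 (one_lt_two_pow_mul h)
  have hmin := minDist_of_complTable_of_subsingleton finZeroElim (by positivity) hF (by simp) hE'
  refine ⟨isWeight_of_complTable finZeroElim (Function.injective_of_subsingleton _) (by positivity)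
    hF (by simp) List.nodup_nil hE', hlen, hdim, ?_, hE.hasWeightTable, fun h2 =>
    isDistanceOptimal_of_two_pow h2 hdim hlen ?_⟩
  · rw [hmin]
    simp only [zpow_sub₀ (two_ne_zero' ℚ), zpow_add₀ (two_ne_zero' ℚ), zpow_natCast, zpow_one]
  · rw [hmin]
    ring

theorem parameters_one_compl (X Y Z W : Finset (Fin m)) (hX : X.card < m)
    (h : 1 ≤ X.card + Y.card + Z.card + W.card) {C}
    (hC : C = binaryCode
      (definingSet (simplicial X)ᶜ (simplicial Y) (simplicial Z) (simplicial W))) :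
    IsWeight 2 C ∧ (length C : ℚ) = (2 ^ m - 2 ^ X.card) * 2 ^ (Y.card + Z.card + W.card) ∧
    dimension C = m + Y.card + Z.card + W.card ∧
    (minDist C : ℚ) = (2 ^ m - 2 ^ X.card) * 2 ^ (Y.card + Z.card + W.card - 1 : ℤ) ∧
    HasWeightTable C (table1 m X.card Y.card Z.card W.card) ∧
    AttainsGriesmer C ∧ IsDistanceOptimal C := by
  obtain ⟨hF, hE, hsum⟩ := hasWeightEnumerator_table1 X Y Z W hX h
  rw [← hC] at hE
  have hdim : dimension C = m + Y.card + Z.card + W.card := hE.dimension_eq (by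
    rw [hsum]; ring)
  have hlen : (length C : ℚ) = (2 ^ m - 2 ^ X.card) * 2 ^ (Y.card + Z.card + W.card) := by
    subst hC
    rw [length_binaryCode, card_definingSet]
    simp only [card_simplicial_cast, card_simplicial_compl_cast]
    ring
  have hE' := hE
  rw [table1_eq _ _ _ hX] at hE'
  have hm : ∀ i, ![X.card] i < m := by simpa using hX
  have h1 := sub_pos.2 (two_pow_lt hX)
  have hmin := minDist_of_complTable_of_subsingleton hm (by positivity) hF (by simp) hE'
  have hG : AttainsGriesmer C := attainsGriesmer_of_two_pow_sub
    (t := X.card + Y.card + Z.card + W.card) h (by omega) hdim (by rw [hlen]; ring)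
    (by rw [hmin]; ring)
  refine ⟨isWeight_of_complTable hm (Function.injective_of_subsingleton _) (by positivity)
    hF (by simp) (by decide) hE', hlen, hdim, ?_, hE.hasWeightTable, hG,
    hG.isDistanceOptimal (by omega)⟩
  rw [hmin]
  simp only [zpow_sub₀ (two_ne_zero' ℚ), zpow_add₀ (two_ne_zero' ℚ), zpow_natCast, zpow_one]
  ring

theorem ratio_mul_sub {x : ℕ} (hx : x < m) : ratio m x * (2 ^ m - 2 ^ x) = 2 ^ x :=
  div_mul_cancel₀ _ (sub_pos.2 (two_pow_lt hx)).ne'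

theorem parameters_two_compl (X Y Z W : Finset (Fin m)) (hXY : X.card ≠ Y.card)
    (hX : X.card < m) (hY : Y.card < m) {C}
    (hC : C = binaryCode
      (definingSet (simplicial X)ᶜ (simplicial Y)ᶜ (simplicial Z) (simplicial W))) :
    IsWeight 4 C ∧
    (length C : ℚ) = (2 ^ m - 2 ^ X.card) * (2 ^ m - 2 ^ Y.card) * 2 ^ (Z.card + W.card) ∧
    dimension C = 2 * m + Z.card + W.card ∧
    (minDist C : ℚ) = (2 ^ m - 2 ^ X.card - 2 ^ Y.card) * 2 ^ (m + Z.card + W.card - 1 : ℤ) ∧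
    HasWeightTable C (table2 m X.card Y.card Z.card W.card) ∧
    (2 ^ (X.card + Y.card + Z.card + W.card) ≤ m + Z.card + W.card + min X.card Y.card →
      IsDistanceOptimal C) := by
  obtain ⟨hF, hE, hsum⟩ := hasWeightEnumerator_table2 X Y Z W hXY hX hY
  rw [← hC] at hE
  have hdim : dimension C = 2 * m + Z.card + W.card := hE.dimension_eq (by
    rw [hsum]; ring)
  have hlen : (length C : ℚ) =
      (2 ^ m - 2 ^ X.card) * (2 ^ m - 2 ^ Y.card) * 2 ^ (Z.card + W.card) := by
    subst hC
    rw [length_binaryCode, card_definingSet]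
    simp only [card_simplicial_cast, card_simplicial_compl_cast]
    ring
  have hE' := hE
  rw [table2_eq _ _ hX hY] at hE'
  have hm : ∀ i, ![X.card, Y.card] i < m := by simp [Fin.forall_fin_succ, hX, hY]
  have h1 := sub_pos.2 (two_pow_lt hX)
  have h2 := sub_pos.2 (two_pow_lt hY)
  have hmem : ∀ i j : Fin 2, i ≠ j → ({i, j} : Finset (Fin 2)) ∈
      [{1}, {0}, ({0, 1} : Finset (Fin 2))] := by decide
  have hne : ∀ T ∈ [{1}, {0}, ({0, 1} : Finset (Fin 2))], T.Nonempty := by simp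
  have hmin : (minDist C : ℚ) =
      (2 ^ m - 2 ^ X.card - 2 ^ Y.card) * 2 ^ m * 2 ^ Z.card * 2 ^ W.card / 2 := by
    have key : (minDist C : ℚ) = (2 ^ m - 2 ^ X.card) * (2 ^ m - 2 ^ Y.card) * 2 ^ Z.card *
        2 ^ W.card / 2 * (1 - ratio m X.card * ratio m Y.card) := by
      rcases lt_or_gt_of_ne hXY with hlt | hlt
      · exact minDist_of_complTable hm (injective_pair hXY) (by positivity) hF hne hE' hmem hlt
          ⟨0, rfl⟩ ⟨1, rfl⟩ (by simp [Fin.forall_fin_succ])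
      · rw [mul_comm (ratio m X.card)]
        exact minDist_of_complTable hm (injective_pair hXY) (by positivity) hF hne hE' hmem hlt
          ⟨1, rfl⟩ ⟨0, rfl⟩ (by simp [Fin.forall_fin_succ])
    rw [key]
    -- The ratios cancel the factors of `N`: `(2^m - 2^x)(2^m - 2^y)` times the product of the
    -- ratios is `2^(x+y)`, which leaves `2^m * (2^m - 2^x - 2^y)`.
    linear_combination -(2 ^ Z.card * 2 ^ W.card / 2) * (ratio m X.card * (2 ^ m - 2 ^ X.card) *
      ratio_mul_sub hY + 2 ^ Y.card * ratio_mul_sub hX)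
  refine ⟨isWeight_of_complTable hm (injective_pair hXY) (by positivity)
    hF hne (by decide) hE', hlen, hdim, ?_, hE.hasWeightTable, fun hle => ?_⟩
  · rw [hmin]
    simp only [zpow_sub₀ (two_ne_zero' ℚ), zpow_add₀ (two_ne_zero' ℚ), zpow_natCast, zpow_one]
    ring
  · rcases lt_or_gt_of_ne hXY with hlt | hlt
    · rw [min_eq_left hlt.le] at hle
      -- The exponents come from expanding `(2^m - 2^x)(2^m - 2^y) * 2^(z+w)`; the last term
      -- `2^(x+y+z+w)` plays the role of `2 ^ t`.
      exact isDistanceOptimal_of_two_pow_sub_sub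
        (a := m + Z.card + W.card + X.card) (b := m + Z.card + W.card + Y.card)
        (by omega) (by omega) hle hdim (by rw [hlen]; ring) (by rw [hmin]; ring)
    · rw [min_eq_right hlt.le] at hle
      exact isDistanceOptimal_of_two_pow_sub_sub
        (a := m + Z.card + W.card + Y.card) (b := m + Z.card + W.card + X.card)
        (by omega) (by omega) hle hdim (by rw [hlen]; ring) (by rw [hmin]; ring)

theorem parameters_three_compl (X Y Z W : Finset (Fin m)) (hXY : X.card ≠ Y.card)
    (hXZ : X.card ≠ Z.card) (hYZ : Y.card ≠ Z.card)
    (hX : X.card < m) (hY : Y.card < m) (hZ : Z.card < m) {C}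
    (hC : C = binaryCode
      (definingSet (simplicial X)ᶜ (simplicial Y)ᶜ (simplicial Z)ᶜ (simplicial W))) :
    IsWeight 8 C ∧
    (length C : ℚ) =
      (2 ^ m - 2 ^ X.card) * (2 ^ m - 2 ^ Y.card) * (2 ^ m - 2 ^ Z.card) * 2 ^ W.card ∧
    dimension C = 3 * m + W.card ∧
    (∀ s₁ s₂ s₃ : ℕ, s₁ < s₂ → s₂ < s₃ →
      ({s₁, s₂, s₃} : Finset ℕ) = {X.card, Y.card, Z.card} →
      (minDist C : ℚ) = (2 ^ m - 2 ^ s₁) * (2 ^ m - 2 ^ s₂ - 2 ^ s₃) * 2 ^ (m + W.card - 1 : ℤ)) ∧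
    HasWeightTable C (table3 m X.card Y.card Z.card W.card) := by
  obtain ⟨hF, hE, hsum⟩ := hasWeightEnumerator_table3 X Y Z W hXY hXZ hYZ hX hY hZ
  rw [← hC] at hE
  have hdim : dimension C = 3 * m + W.card := hE.dimension_eq (by rw [hsum]; ring)
  have hlen : (length C : ℚ) =
      (2 ^ m - 2 ^ X.card) * (2 ^ m - 2 ^ Y.card) * (2 ^ m - 2 ^ Z.card) * 2 ^ W.card := by
    subst hC
    rw [length_binaryCode, card_definingSet]
    simp only [card_simplicial_cast, card_simplicial_compl_cast]
    ring
  have hE' := hE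
  rw [table3_eq _ hX hY hZ] at hE'
  have hm : ∀ i, ![X.card, Y.card, Z.card] i < m := by simp [Fin.forall_fin_succ, hX, hY, hZ]
  have h1 := sub_pos.2 (two_pow_lt hX)
  have h2 := sub_pos.2 (two_pow_lt hY)
  have h3 := sub_pos.2 (two_pow_lt hZ)
  refine ⟨isWeight_of_complTable hm (injective_triple hXY hXZ hYZ) (by positivity)
    hF (by simp) (by decide) hE', hlen, hdim, fun s₁ s₂ s₃ h12 h23 hs => ?_, hE.hasWeightTable⟩
  -- Only the set of cardinalities matters: it identifies `s₂` and `s₃` as the two largest exponents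
  -- and lets the length be rewritten in the sorted order.
  have hset : ∀ p, (∃ i, ![X.card, Y.card, Z.card] i = p) ↔ p = s₁ ∨ p = s₂ ∨ p = s₃ := by
    intro p
    have := congrArg (p ∈ ·) hs
    simp only [Finset.mem_insert, Finset.mem_singleton, eq_iff_iff] at this
    rw [this]
    simp [Fin.exists_fin_succ, eq_comm]
  have hlt : ∀ p, p = s₁ ∨ p = s₂ ∨ p = s₃ → p < m := by
    intro p hp
    obtain ⟨i, rfl⟩ := (hset p).2 hp
    exact hm i
  have hprod : ((2 : ℚ) ^ m - 2 ^ X.card) * (2 ^ m - 2 ^ Y.card) * (2 ^ m - 2 ^ Z.card) =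
      (2 ^ m - 2 ^ s₁) * (2 ^ m - 2 ^ s₂) * (2 ^ m - 2 ^ s₃) := by
    have := congrArg (fun S : Finset ℕ => ∏ p ∈ S, ((2 : ℚ) ^ m - 2 ^ p)) hs
    rw [Finset.prod_insert (by simp; omega), Finset.prod_insert (by simp; omega),
      Finset.prod_singleton, Finset.prod_insert (by simp; omega),
      Finset.prod_insert (by simp; omega), Finset.prod_singleton] at this
    linear_combination -this
  rw [minDist_of_complTable hm (injective_triple hXY hXZ hYZ) (by positivity) hF (by simp) hE'
    (by decide) h23 ((hset _).2 (by simp)) ((hset _).2 (by simp)) (fun k => by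
      have := (hset _).1 ⟨k, rfl⟩
      omega), hprod]
  simp only [zpow_sub₀ (two_ne_zero' ℚ), zpow_add₀ (two_ne_zero' ℚ), zpow_natCast, zpow_one]
  linear_combination -((2 ^ m - 2 ^ s₁) * 2 ^ W.card / 2) * (ratio m s₂ * (2 ^ m - 2 ^ s₂) *
    ratio_mul_sub (hlt s₃ (by simp)) + 2 ^ s₃ * ratio_mul_sub (hlt s₂ (by simp)))

theorem parameters_four_compl (X Y Z W : Finset (Fin m)) (hXY : X.card ≠ Y.card)
    (hXZ : X.card ≠ Z.card) (hXW : X.card ≠ W.card) (hYZ : Y.card ≠ Z.card)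
    (hYW : Y.card ≠ W.card) (hZW : Z.card ≠ W.card)
    (hX : X.card < m) (hY : Y.card < m) (hZ : Z.card < m) (hW : W.card < m) {C}
    (hC : C = binaryCode
      (definingSet (simplicial X)ᶜ (simplicial Y)ᶜ (simplicial Z)ᶜ (simplicial W)ᶜ)) :
    IsWeight 16 C ∧
    (length C : ℚ) =
      (2 ^ m - 2 ^ X.card) * (2 ^ m - 2 ^ Y.card) * (2 ^ m - 2 ^ Z.card) * (2 ^ m - 2 ^ W.card) ∧
    dimension C = 4 * m ∧
    (∀ s₁ s₂ s₃ s₄ : ℕ, s₁ < s₂ → s₂ < s₃ → s₃ < s₄ →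
      ({s₁, s₂, s₃, s₄} : Finset ℕ) = {X.card, Y.card, Z.card, W.card} →
      (minDist C : ℚ) =
        (2 ^ m - 2 ^ s₁) * (2 ^ m - 2 ^ s₂) * (2 ^ m - 2 ^ s₃ - 2 ^ s₄) * 2 ^ (m - 1 : ℤ)) ∧
    HasWeightTable C (table4 m X.card Y.card Z.card W.card) := by
  obtain ⟨hF, hE, hsum⟩ := hasWeightEnumerator_table4 X Y Z W hXY hXZ hXW hYZ hYW hZW hX hY hZ hW
  rw [← hC] at hE
  have hdim : dimension C = 4 * m := hE.dimension_eq (by rw [hsum]; ring)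
  have hlen : (length C : ℚ) =
      (2 ^ m - 2 ^ X.card) * (2 ^ m - 2 ^ Y.card) * (2 ^ m - 2 ^ Z.card) *
        (2 ^ m - 2 ^ W.card) := by
    subst hC
    rw [length_binaryCode, card_definingSet]
    simp only [card_simplicial_compl_cast]
    ring
  have hE' := hE
  rw [table4_eq hX hY hZ hW] at hE'
  have hm : ∀ i, ![X.card, Y.card, Z.card, W.card] i < m := by
    simp [Fin.forall_fin_succ, hX, hY, hZ, hW]
  have h1 := sub_pos.2 (two_pow_lt hX)
  have h2 := sub_pos.2 (two_pow_lt hY)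
  have h3 := sub_pos.2 (two_pow_lt hZ)
  have h4 := sub_pos.2 (two_pow_lt hW)
  have hinj := injective_quadruple hXY hXZ hXW hYZ hYW hZW
  refine ⟨isWeight_of_complTable hm hinj (by positivity) hF (by simp) (by decide) hE', hlen, hdim,
    fun s₁ s₂ s₃ s₄ h12 h23 h34 hs => ?_, hE.hasWeightTable⟩
  have hset : ∀ p, (∃ i, ![X.card, Y.card, Z.card, W.card] i = p) ↔
      p = s₁ ∨ p = s₂ ∨ p = s₃ ∨ p = s₄ := by
    intro p
    have := congrArg (p ∈ ·) hs
    simp only [Finset.mem_insert, Finset.mem_singleton, eq_iff_iff] at this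
    rw [this]
    simp [Fin.exists_fin_succ, eq_comm]
  have hlt : ∀ p, p = s₁ ∨ p = s₂ ∨ p = s₃ ∨ p = s₄ → p < m := by
    intro p hp
    obtain ⟨i, rfl⟩ := (hset p).2 hp
    exact hm i
  have hprod : ((2 : ℚ) ^ m - 2 ^ X.card) * (2 ^ m - 2 ^ Y.card) * (2 ^ m - 2 ^ Z.card) *
      (2 ^ m - 2 ^ W.card) =
      (2 ^ m - 2 ^ s₁) * (2 ^ m - 2 ^ s₂) * (2 ^ m - 2 ^ s₃) * (2 ^ m - 2 ^ s₄) := by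
    have := congrArg (fun S : Finset ℕ => ∏ p ∈ S, ((2 : ℚ) ^ m - 2 ^ p)) hs
    rw [Finset.prod_insert (by simp; omega), Finset.prod_insert (by simp; omega),
      Finset.prod_insert (by simp; omega), Finset.prod_singleton,
      Finset.prod_insert (by simp; omega), Finset.prod_insert (by simp; omega),
      Finset.prod_insert (by simp; omega), Finset.prod_singleton] at this
    linear_combination -this
  rw [minDist_of_complTable hm hinj (by positivity) hF (by simp) hE' (by decide) h34
    ((hset _).2 (by simp)) ((hset _).2 (by simp)) (fun k => by
      have := (hset _).1 ⟨k, rfl⟩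
      omega), hprod]
  simp only [zpow_sub₀ (two_ne_zero' ℚ), zpow_natCast, zpow_one]
  linear_combination -((2 ^ m - 2 ^ s₁) * (2 ^ m - 2 ^ s₂) / 2) *
    (ratio m s₃ * (2 ^ m - 2 ^ s₃) * ratio_mul_sub (hlt s₄ (by simp)) +
      2 ^ s₄ * ratio_mul_sub (hlt s₃ (by simp)))

theorem parameters_complSet (X Y Z W : Finset (Fin m))
    (h : 1 ≤ X.card + Y.card + Z.card + W.card)
    (hlt : X.card + Y.card + Z.card + W.card < 4 * m) {C}
    (hC : C = binaryCode (complSet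
      (definingSet (simplicial X) (simplicial Y) (simplicial Z) (simplicial W)))) :
    IsWeight 2 C ∧ (length C : ℚ) = 2 ^ (4 * m) - 2 ^ (X.card + Y.card + Z.card + W.card) ∧
    dimension C = 4 * m ∧
    (minDist C : ℚ) =
      2 ^ (4 * m - 1 : ℤ) - 2 ^ (X.card + Y.card + Z.card + W.card - 1 : ℤ) ∧
    HasWeightTable C (tableCompl m X.card Y.card Z.card W.card) ∧
    AttainsGriesmer C ∧ IsDistanceOptimal C := by
  obtain ⟨hF, hE, hsum⟩ := hasWeightEnumerator_tableCompl X Y Z W h hlt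
  rw [← hC] at hE
  have hdim : dimension C = 4 * m := hE.dimension_eq hsum
  have hlen : (length C : ℚ) = 2 ^ (4 * m) - 2 ^ (X.card + Y.card + Z.card + W.card) := by
    subst hC
    rw [length_binaryCode, card_complSet, card_definingSet]
    simp only [card_simplicial_cast]
    ring
  have hE' := hE
  rw [tableCompl_eq hlt] at hE'
  have hm : ∀ i, ![X.card + Y.card + Z.card + W.card] i < 4 * m := by simpa using hlt
  have hN := sub_pos.2 (two_pow_lt hlt)
  have hmin := minDist_of_complTable_of_subsingleton hm hN hF (by simp) hE'
  have hG : AttainsGriesmer C := attainsGriesmer_of_two_pow_sub h hlt hdim hlen hmin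
  refine ⟨isWeight_of_complTable hm (Function.injective_of_subsingleton _) hN hF (by simp)
    (by decide) hE', hlen, hdim, ?_, hE.hasWeightTable, hG, hG.isDistanceOptimal (by omega)⟩
  rw [hmin, sub_div, zpow_sub₀ two_ne_zero, zpow_sub₀ two_ne_zero, zpow_one]
  norm_cast

end Parameters

end SubfieldCode

theorem theorem4p2 (m : ℕ) (X Y Z W : Finset (Fin m)) (x y z w : ℕ)
    (hx : X.card = x) (hy : Y.card = y) (hz : Z.card = z) (hw : W.card = w) :
    -- no complement
    (∀ D, D = definingSet (simplicial X) (simplicial Y) (simplicial Z) (simplicial W) →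
      1 ≤ x + y + z + w →
      IsWeight 1 (binaryCode D) ∧
      (length (binaryCode D) : ℚ) = 2 ^ (x + y + z + w) ∧
      dimension (binaryCode D) = x + y + z + w ∧
      (minDist (binaryCode D) : ℚ) = 2 ^ (x + y + z + w - 1 : ℤ) ∧
      HasWeightTable (binaryCode D) (table0 x y z w) ∧
      (2 ≤ x + y + z + w → IsDistanceOptimal (binaryCode D))) ∧
    -- one complement
    (∀ D, D = definingSet (simplicial X)ᶜ (simplicial Y) (simplicial Z) (simplicial W) →
      x < m → 1 ≤ x + y + z + w →
      IsWeight 2 (binaryCode D) ∧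
      (length (binaryCode D) : ℚ) = (2 ^ m - 2 ^ x) * 2 ^ (y + z + w) ∧
      dimension (binaryCode D) = m + y + z + w ∧
      (minDist (binaryCode D) : ℚ) = (2 ^ m - 2 ^ x) * 2 ^ (y + z + w - 1 : ℤ) ∧
      HasWeightTable (binaryCode D) (table1 m x y z w) ∧
      AttainsGriesmer (binaryCode D) ∧
      IsDistanceOptimal (binaryCode D)) ∧
    -- two complements
    (∀ D, D = definingSet (simplicial X)ᶜ (simplicial Y)ᶜ (simplicial Z) (simplicial W) →
      x ≠ y → x < m → y < m →
      IsWeight 4 (binaryCode D) ∧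
      (length (binaryCode D) : ℚ) = (2 ^ m - 2 ^ x) * (2 ^ m - 2 ^ y) * 2 ^ (z + w) ∧
      dimension (binaryCode D) = 2 * m + z + w ∧
      (minDist (binaryCode D) : ℚ) = (2 ^ m - 2 ^ x - 2 ^ y) * 2 ^ (m + z + w - 1 : ℤ) ∧
      HasWeightTable (binaryCode D) (table2 m x y z w) ∧
      (2 ^ (x + y + z + w) ≤ m + z + w + min x y → IsDistanceOptimal (binaryCode D))) ∧
    -- three complements
    (∀ D, D = definingSet (simplicial X)ᶜ (simplicial Y)ᶜ (simplicial Z)ᶜ (simplicial W) →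
      x ≠ y → x ≠ z → y ≠ z → x < m → y < m → z < m →
      IsWeight 8 (binaryCode D) ∧
      (length (binaryCode D) : ℚ) =
        (2 ^ m - 2 ^ x) * (2 ^ m - 2 ^ y) * (2 ^ m - 2 ^ z) * 2 ^ w ∧
      dimension (binaryCode D) = 3 * m + w ∧
      (∀ s₁ s₂ s₃ : ℕ, s₁ < s₂ → s₂ < s₃ → ({s₁, s₂, s₃} : Finset ℕ) = {x, y, z} →
        (minDist (binaryCode D) : ℚ) =
          (2 ^ m - 2 ^ s₁) * (2 ^ m - 2 ^ s₂ - 2 ^ s₃) * 2 ^ (m + w - 1 : ℤ)) ∧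
      HasWeightTable (binaryCode D) (table3 m x y z w)) ∧
    -- four complements
    (∀ D, D = definingSet (simplicial X)ᶜ (simplicial Y)ᶜ (simplicial Z)ᶜ (simplicial W)ᶜ →
      x ≠ y → x ≠ z → x ≠ w → y ≠ z → y ≠ w → z ≠ w → x < m → y < m → z < m → w < m →
      IsWeight 16 (binaryCode D) ∧
      (length (binaryCode D) : ℚ) =
        (2 ^ m - 2 ^ x) * (2 ^ m - 2 ^ y) * (2 ^ m - 2 ^ z) * (2 ^ m - 2 ^ w) ∧
      dimension (binaryCode D) = 4 * m ∧
      (∀ s₁ s₂ s₃ s₄ : ℕ, s₁ < s₂ → s₂ < s₃ → s₃ < s₄ →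
        ({s₁, s₂, s₃, s₄} : Finset ℕ) = {x, y, z, w} →
        (minDist (binaryCode D) : ℚ) =
          (2 ^ m - 2 ^ s₁) * (2 ^ m - 2 ^ s₂) * (2 ^ m - 2 ^ s₃ - 2 ^ s₄) * 2 ^ (m - 1 : ℤ)) ∧
      HasWeightTable (binaryCode D) (table4 m x y z w)) ∧
    -- complement of the whole set
    (∀ D, D = complSet (definingSet (simplicial X) (simplicial Y) (simplicial Z) (simplicial W)) →
      1 ≤ x + y + z + w → x + y + z + w < 4 * m →
      IsWeight 2 (binaryCode D) ∧
      (length (binaryCode D) : ℚ) = 2 ^ (4 * m) - 2 ^ (x + y + z + w) ∧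
      dimension (binaryCode D) = 4 * m ∧
      (minDist (binaryCode D) : ℚ) = 2 ^ (4 * m - 1 : ℤ) - 2 ^ (x + y + z + w - 1 : ℤ) ∧
      HasWeightTable (binaryCode D) (tableCompl m x y z w) ∧
      AttainsGriesmer (binaryCode D) ∧
      IsDistanceOptimal (binaryCode D)) := by
  subst hx hy hz hw
  refine ⟨?_, ?_, ?_, ?_, ?_, ?_⟩ <;> rintro D rfl
  · exact fun h => parameters_no_compl X Y Z W h rfl
  · exact fun hX h => parameters_one_compl X Y Z W hX h rfl
  · exact fun hXY hX hY => parameters_two_compl X Y Z W hXY hX hY rfl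
  · exact fun hXY hXZ hYZ hX hY hZ => parameters_three_compl X Y Z W hXY hXZ hYZ hX hY hZ rfl
  · exact fun hXY hXZ hXW hYZ hYW hZW hX hY hZ hW =>
      parameters_four_compl X Y Z W hXY hXZ hXW hYZ hYW hZW hX hY hZ hW rfl
  · exact fun h hlt => parameters_complSet X Y Z W h hlt rfl
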